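/- Let $\mathcal M=(E,\mathcal F)$ be a matroid on a finite ground set $E$ with family of independent sets $\mathcal F$, and for an integer $k\ge 1$ let $$\mathcal F^k=\{F_1\cup F_2\cup\cdots\cup F_k : F_1,\dots,F_k\in\mathcal F\}$$ be the family of feasible sets of the $k$-fold union of $\mathcal M$. A prophet inequality instance $(E,\mathcal F^k,\{\mathcal D_e\}_{e\in E})$ also has, for each $e\in E$, a probability distribution $\mathcal D_e$ on $\mathbb R$. The values $v_e\sim\mathcal D_e$ are independent. The elements of $E$ arrive one at a time; when $e$ arrives, $v_e$ is revealed to a (possibly randomized) online algorithm, which knows the instance in advance and immediately and irrevocably accepts or rejects $e$, on the basis of what has been revealed so far and of its internal randomness only. The set of accepted elements must belong to $\mathcal F^k$ at all times; let $A$ be the final set of accepted elements. The order of arrival is chosen by an almighty adversary, i.e. it may depend in an arbitrary (measurable) way on all the values $(v_e)_{e\in E}$ and on all the internal randomness of the algorithm, hence also on its decisions. The algorithm is a $c$-competitive prophet inequality for the instance if, against every such adversary, $$\mathbb E\Big[\sum_{e\in A}v_e\Big]\ \ge\ c\cdot\mathbb E\Big[\max_{S\in\mathcal F^k}\sum_{e\in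 S}v_e\Big],$$ where expectations are taken in the extended sense $\mathbb E[X]=\mathbb E[X^+]-\mathbb E[X^-]$, with the value $-\infty$ if both parts are infinite. **Theorem.** There is an absolute constant $C>0$ such that for every integer $k\ge 2$, every matroid $(E,\mathcal F)$ on a finite ground set, and every prophet inequality instance $(E,\mathcal F^k,\{\mathcal D_e\}_{e\in E})$ on its $k$-fold union, there exists a $\left(1-C\sqrt{\frac{\log k}{k}}\right)$-competitive prophet inequality. -/

import Mathlib

open MeasureTheory

noncomputable section

namespace Prophet

/-- The feasible sets of the `k`-fold union of a matroid `M`: all unions `I₁ ∪ ⋯ ∪ I_k` of `k`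
independent sets of `M`. -/
def kFoldUnion {E : Type*} [DecidableEq E] (M : Matroid E) (k : ℕ) : Set (Finset E) :=
  {S | ∃ I : Fin k → Finset E, (∀ i, M.Indep (I i : Set E)) ∧ S = Finset.univ.biUnion I}

/-- The prophet's reward `max_{S ∈ F} ∑_{e ∈ S} v_e` (the family `F` is finite, so the supremum is a
maximum as soon as `F` is non-empty). -/
def opt {E : Type*} (F : Set (Finset E)) (v : E → ℝ) : ℝ :=
  sSup ((fun S : Finset E => ∑ e ∈ S, v e) '' F)

/-- The expectation `𝔼[X⁺] - 𝔼[X⁻]` of a real random variable, as an extended real number.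
In `EReal` one has `⊤ - ⊤ = ⊥`, so an undefined expectation counts as `-∞`. -/
def expect {Ω : Type*} [MeasurableSpace Ω] (μ : Measure Ω) (X : Ω → ℝ) : EReal :=
  ((∫⁻ ω, ENNReal.ofReal (X ω) ∂μ : ENNReal) : EReal) -
    ((∫⁻ ω, ENNReal.ofReal (-X ω) ∂μ : ENNReal) : EReal)

/-- A randomized online algorithm. Its internal randomness is a point of the probability space
`(Ω, P)`. `accept r past e x` is the decision on the arriving element `e` with revealed value `x`
when the internal randomness is `r` and `past` lists the elements that arrived before together with
their values, the most recent first. The decision can use nothing else; in particular it can use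
neither the values nor the order of the elements still to come. (The earlier decisions of the
algorithm are determined by `r` and `past`.) -/
structure OnlineAlgorithm (E : Type*) where
  Ω : Type
  [measurableSpace : MeasurableSpace Ω]
  P : Measure Ω
  [isProbabilityMeasure : IsProbabilityMeasure P]
  accept : Ω → List (E × ℝ) → E → ℝ → Bool
  measurableSet_accept : ∀ (past : List E) (e : E),
    MeasurableSet {p : (E → ℝ) × Ω |
      accept p.2 (past.map fun a => (a, p.1 a)) e (p.1 e) = true}

attribute [instance] OnlineAlgorithm.measurableSpace OnlineAlgorithm.isProbabilityMeasure

/-- The set of elements accepted by the algorithm once the elements of a list have arrived, the head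
of the list being the most recent arrival, when the values are `v` and the internal randomness is
`r`. -/
def OnlineAlgorithm.accepted {E : Type*} [DecidableEq E] (A : OnlineAlgorithm E)
    (v : E → ℝ) (r : A.Ω) : List E → Finset E
  | [] => ∅
  | e :: past =>
    if A.accept r (past.map fun a => (a, v a)) e (v e) = true then
      insert e (A.accepted v r past)
    else A.accepted v r past

/-- At all times, for all values, all internal randomness and all arrival orders, the set of
accepted elements is feasible. (The lists without repetition are exactly the sequences of
elements that can have arrived at some time.) -/
def OnlineAlgorithm.Maintains {E : Type*} [DecidableEq E] (A : OnlineAlgorithm E)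
    (F : Set (Finset E)) : Prop :=
  ∀ (v : E → ℝ) (r : A.Ω) (l : List E), l.Nodup → A.accepted v r l ∈ F

/-- An arrival order of all the elements, the last arrival first. -/
def ArrivalOrder (E : Type*) : Type _ := {l : List E // l.Nodup ∧ ∀ e, e ∈ l}

/-- An almighty adversary: it picks the arrival order with full knowledge of all values and of all
internal randomness of the algorithm (hence also of all decisions of the algorithm). -/
structure AlmightyAdversary {E : Type*} (A : OnlineAlgorithm E) where
  order : (E → ℝ) × A.Ω → ArrivalOrder E
  measurableSet_order : ∀ l : ArrivalOrder E, MeasurableSet (order ⁻¹' {l})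

/-- The algorithm `A` is a `c`-competitive prophet inequality, against the almighty adversary, for
the instance with feasible sets `F` and independent values `v_e` of law `D e`. -/
def IsCompetitive {E : Type*} [Fintype E] [DecidableEq E] (F : Set (Finset E))
    (D : E → Measure ℝ) (c : ℝ) (A : OnlineAlgorithm E) : Prop :=
  A.Maintains F ∧
    ∀ σ : AlmightyAdversary A,
      (c : EReal) * expect (Measure.pi D) (opt F) ≤
        expect ((Measure.pi D).prod A.P)
          (fun p => ∑ e ∈ A.accepted p.1 p.2 (σ.order p).1, p.1 e)

end Prophet

end

/-!
The algorithm is a greedy online contention resolution scheme for the `k`-fold union, applied to an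
ex-ante relaxation of the prophet.

*Relaxation.* Conditioning the optimal choice on the value of a single element turns the prophet
into independent activity probabilities `q e t` whose means `x` satisfy `∑ e ∈ T, x e ≤ k * r T`,
where `r` is the rank function, and whose expected weight dominates the expected optimum
(`exists_exAnte`). Each element is declared active independently, with probability
`exp (-l) * (1 - ε) * q e t`, by an internal coin.

*Chain.* The ground set is split into levels along a chain, and an active element is accepted if the
accepted elements of its level stay independent in the `k`-fold union of the corresponding minor.
Whatever the order of arrival, an active element can be lost only if the other active elements
block it (`mem_greedySet`, `blocked_of_not_levelFamily_insert`), an event independent of the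
element itself. The union over all levels satisfies `|T| ≤ k * r T` for all its subsets `T`
(`card_le_of_forall_contractIndep`), hence is a union of `k` independent sets by Edmonds' partition
theorem (`mem_kFoldUnion_of_card_le`).

*Room.* For a random active set `R`, the room of `e` over `S` is the increment, from `S` to
`S ∪ {e}`, of the shifted rank `min_{X ⊇ S} (k * r X + |R \ X|)`. It vanishes when `e` is blocked
(`Blocked.shiftedRank_le`), and it is antitone and `1`-Lipschitz in `R`. Since the rates
`(1 - ε) * x` leave slack `ε` in the polytope, the next set of the chain can be chosen so that all
elements outside it have expected room at least `ε * k` (`exists_contraction`).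

*Concentration.* For an antitone `1`-Lipschitz `h`, lowering the rates by the factor `exp (-l)`
gives `𝔼' exp (-l * h) ≤ exp (-l * 𝔼 h)` (`bernE_exp_le`), so an element is blocked with probability
at most `exp (-l * ε * k)`. With `ε = l = √(log k / k)` this is `1 / k`, and the competitive ratio
is at least `exp (-l) * (1 - ε) * (1 - 1 / k) ≥ 1 - 3 * √(log k / k)`.
-/

namespace Prophet

/-! ### Rank functions and matroid partition -/

/-- A normalised, monotone, submodular integer-valued set function on finite sets. -/
structure IsPolymatroid {E : Type*} [DecidableEq E] (r : Finset E → ℕ) : Prop where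
  empty : r ∅ = 0
  mono : Monotone r
  submod : ∀ S T, r (S ∪ T) + r (S ∩ T) ≤ r S + r T

/-- The rank of a finite set in a matroid, as a natural number. -/
noncomputable def finRk {E : Type*} (M : Matroid E) (S : Finset E) : ℕ := (M.eRk (S : Set E)).toNat

section Rank

theorem coe_finRk {E : Type*} (M : Matroid E) (S : Finset E) :
    (finRk M S : ℕ∞) = M.eRk (S : Set E) :=
  ENat.natCast_toNat ((M.eRk_le_encard _).trans_lt S.finite_toSet.encard_lt_top).ne

theorem finRk_le_card {E : Type*} (M : Matroid E) (S : Finset E) : finRk M S ≤ S.card := by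
  have h := M.eRk_le_encard (S : Set E)
  rw [← coe_finRk, Set.encard_coe_eq_coe_finsetCard] at h
  exact_mod_cast h

theorem indep_iff_card_le_finRk {E : Type*} (M : Matroid E) (S : Finset E) :
    M.Indep (S : Set E) ↔ S.card ≤ finRk M S := by
  rw [Matroid.indep_iff_eRk_eq_encard_of_finite S.finite_toSet, ← coe_finRk,
    Set.encard_coe_eq_coe_finsetCard, Nat.cast_inj]
  have := finRk_le_card M S
  omega

variable {E : Type*} [DecidableEq E]

theorem isPolymatroid_finRk (M : Matroid E) : IsPolymatroid (finRk M) where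
  empty := by simp [finRk]
  mono S T h := by
    have := M.eRk_mono (Finset.coe_subset.2 h)
    rw [← coe_finRk, ← coe_finRk] at this
    exact_mod_cast this
  submod S T := by
    have := M.eRk_inter_add_eRk_union_le (S : Set E) T
    rw [← Finset.coe_inter, ← Finset.coe_union, ← coe_finRk, ← coe_finRk, ← coe_finRk,
      ← coe_finRk] at this
    have h : finRk M (S ∩ T) + finRk M (S ∪ T) ≤ finRk M S + finRk M T := by exact_mod_cast this
    omega

/-- Rado's shrinking argument. If colour lists `L e` satisfy the Hall-type condition for a
polymatroid `r`, the lists can be cut down to length at most one without losing the condition: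
if neither of two colours could be removed from a list, submodularity applied to two violating
sets would contradict the condition. -/
theorem IsPolymatroid.exists_list_card_le_one {r : Finset E → ℕ} (hr : IsPolymatroid r) {k : ℕ}
    (A : Finset E) (L : E → Finset (Fin k))
    (hL : ∀ J ⊆ A, J.card ≤ ∑ i, r (J.filter fun e => i ∈ L e)) :
    ∃ L' : E → Finset (Fin k), (∀ e ∈ A, (L' e).card ≤ 1) ∧
      ∀ J ⊆ A, J.card ≤ ∑ i, r (J.filter fun e => i ∈ L' e) := by
  induction hn : ∑ e ∈ A, (L e).card using Nat.strong_induction_on generalizing L with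
  | _ n ih =>
  by_cases hone : ∀ e ∈ A, (L e).card ≤ 1
  · exact ⟨L, hone, hL⟩
  push Not at hone
  obtain ⟨e, heA, he⟩ := hone
  obtain ⟨x, hx, y, hy, hxy⟩ := Finset.one_lt_card.1 he
  have hlt : ∀ z ∈ L e,
      ∑ f ∈ A, (Function.update L e ((L e).erase z) f).card < ∑ f ∈ A, (L f).card := by
    intro z hz
    refine Finset.sum_lt_sum (fun f _ => ?_) ⟨e, heA, ?_⟩
    · by_cases hf : f = e
      · subst hf; simpa using Finset.card_le_card (Finset.erase_subset z _)
      · simp [hf]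
    · simpa using Finset.card_erase_lt_of_mem hz
  have key : ∀ z ∈ L e,
      (∀ J ⊆ A, J.card ≤ ∑ i, r (J.filter fun f => i ∈ Function.update L e ((L e).erase z) f)) →
      ∃ L' : E → Finset (Fin k), (∀ e ∈ A, (L' e).card ≤ 1) ∧
        ∀ J ⊆ A, J.card ≤ ∑ i, r (J.filter fun e => i ∈ L' e) :=
    fun z hz h => ih _ (hn ▸ hlt z hz) _ h rfl
  by_contra hcon
  have viol : ∀ z ∈ L e, ∃ J ⊆ A, e ∈ J ∧
      ∑ i, r (J.filter fun f => i ∈ Function.update L e ((L e).erase z) f) < J.card := by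
    intro z hz
    obtain ⟨J, hJA, hJ⟩ : ∃ J ⊆ A,
        ∑ i, r (J.filter fun f => i ∈ Function.update L e ((L e).erase z) f) < J.card := by
      by_contra! h
      exact hcon (key z hz h)
    refine ⟨J, hJA, ?_, hJ⟩
    by_contra heJ
    refine absurd (hL J hJA) (not_le.2 (lt_of_eq_of_lt (Finset.sum_congr rfl fun i _ => ?_) hJ))
    congr 1
    refine Finset.filter_congr fun f hf => ?_
    rw [Function.update_of_ne]
    rintro rfl
    exact heJ hf
  obtain ⟨J₁, hJ₁A, heJ₁, hJ₁⟩ := viol x hx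
  obtain ⟨J₂, hJ₂A, heJ₂, hJ₂⟩ := viol y hy
  have hU := hL (J₁ ∪ J₂) (Finset.union_subset hJ₁A hJ₂A)
  have hI := hL ((J₁ ∩ J₂).erase e)
    ((Finset.erase_subset _ _).trans (Finset.inter_subset_left.trans hJ₁A))
  have hsum : ∑ i, r ((J₁ ∪ J₂).filter fun f => i ∈ L f) +
      ∑ i, r (((J₁ ∩ J₂).erase e).filter fun f => i ∈ L f) ≤
      ∑ i, r (J₁.filter fun f => i ∈ Function.update L e ((L e).erase x) f) +
      ∑ i, r (J₂.filter fun f => i ∈ Function.update L e ((L e).erase y) f) := by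
    rw [← Finset.sum_add_distrib, ← Finset.sum_add_distrib]
    refine Finset.sum_le_sum fun i _ => le_trans (add_le_add (hr.mono ?_) (hr.mono ?_))
      (hr.submod _ _)
    · intro f hf
      simp only [Finset.mem_filter, Finset.mem_union] at hf ⊢
      by_cases hfe : f = e
      · subst hfe
        simp only [Function.update_self, Finset.mem_erase]
        by_cases hix : i = x
        · exact Or.inr ⟨heJ₂, hix ▸ hxy, hf.2⟩
        · exact Or.inl ⟨heJ₁, hix, hf.2⟩
      · simp only [Function.update_of_ne hfe]
        tauto
    · intro f hf
      simp only [Finset.mem_filter, Finset.mem_erase, Finset.mem_inter] at hf ⊢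
      simp only [Function.update_of_ne hf.1.1]
      tauto
  have hc := Finset.card_union_add_card_inter J₁ J₂
  have he' := Finset.card_erase_add_one (Finset.mem_inter.2 ⟨heJ₁, heJ₂⟩)
  omega

/-- Edmonds' matroid partition theorem: a set all of whose subsets `T` have at most `k • rank T`
elements is a union of `k` independent sets. -/
theorem mem_kFoldUnion_of_card_le (M : Matroid E) (k : ℕ) (A : Finset E)
    (hA : ∀ T ⊆ A, T.card ≤ k * finRk M T) : A ∈ kFoldUnion M k := by
  obtain ⟨L, hL1, hL⟩ := (isPolymatroid_finRk M).exists_list_card_le_one A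
    (fun _ => (Finset.univ : Finset (Fin k))) (fun J hJ => by simpa using hA J hJ)
  -- Lists of length at most one: the colour classes have total size at most `|A|`, which is at most
  -- the sum of their ranks, so every class has full rank.
  have hcount : ∑ i, (A.filter fun e => i ∈ L e).card ≤ A.card := by
    calc ∑ i, (A.filter fun e => i ∈ L e).card = ∑ e ∈ A, (L e).card := by
          simp only [Finset.card_filter]
          rw [Finset.sum_comm]
          refine Finset.sum_congr rfl fun e _ => ?_
          simp
      _ ≤ ∑ e ∈ A, 1 := Finset.sum_le_sum hL1
      _ = A.card := by simp
  have hle : ∀ i ∈ Finset.univ, finRk M (A.filter fun e => i ∈ L e) ≤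
      (A.filter fun e => i ∈ L e).card := fun i _ => finRk_le_card M _
  have heq := (Finset.sum_eq_sum_iff_of_le hle).1
    (le_antisymm (Finset.sum_le_sum hle) (hcount.trans (hL A subset_rfl)))
  refine ⟨fun i => A.filter fun e => i ∈ L e, fun i => ?_, ?_⟩
  · rw [indep_iff_card_le_finRk]
    exact (heq i (Finset.mem_univ i)).ge
  · ext e
    simp only [Finset.mem_biUnion, Finset.mem_univ, true_and, Finset.mem_filter]
    refine ⟨fun he => ?_, fun ⟨_, h, _⟩ => h⟩
    by_contra hno
    push Not at hno
    have h1 := hL {e} (by simpa using he)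
    have h0 : ∀ i, ({e} : Finset E).filter (fun e => i ∈ L e) = ∅ := fun i => by
      simp [Finset.filter_singleton, hno i he]
    simp [h0, (isPolymatroid_finRk M).empty] at h1

theorem card_inter_le_of_mem_kFoldUnion (M : Matroid E) {k : ℕ} {S : Finset E}
    (hS : S ∈ kFoldUnion M k) (T : Finset E) : (S ∩ T).card ≤ k * finRk M T := by
  obtain ⟨I, hI, rfl⟩ := hS
  rw [Finset.biUnion_inter]
  refine Finset.card_biUnion_le.trans
    ((Finset.sum_le_card_nsmul _ _ (finRk M T) fun i _ => ?_).trans (by simp))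
  have h : M.Indep ((I i ∩ T : Finset E) : Set E) := (hI i).subset (by simp)
  exact ((indep_iff_card_le_finRk M _).1 h).trans
    ((isPolymatroid_finRk M).mono Finset.inter_subset_right)

end Rank

/-! ### Concentration for independent random sets -/

/-- The expectation of `f R`, where `R` contains each `e ∈ s` independently with
probability `z e`. -/
def bernE {E : Type*} [DecidableEq E] (s : Finset E) (z : E → ℝ) (f : Finset E → ℝ) : ℝ :=
  ∑ T ∈ s.powerset, (∏ e ∈ T, z e) * (∏ e ∈ s \ T, (1 - z e)) * f T

section Bern

variable {E : Type*} [DecidableEq E]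

theorem bernE_insert {s : Finset E} {a : E} (ha : a ∉ s) (z : E → ℝ) (f : Finset E → ℝ) :
    bernE (insert a s) z f =
      bernE s z (fun T => (1 - z a) * f T + z a * f (insert a T)) := by
  unfold bernE
  rw [Finset.sum_powerset_insert ha, ← Finset.sum_add_distrib]
  refine Finset.sum_congr rfl fun T hT => ?_
  have hT' := Finset.mem_powerset.1 hT
  have haT : a ∉ T := fun h => ha (hT' h)
  have h1 : insert a s \ T = insert a (s \ T) := Finset.insert_sdiff_of_notMem _ haT
  have h2 : insert a s \ insert a T = s \ T := by
    ext x; simp only [Finset.mem_sdiff, Finset.mem_insert]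
    by_cases hx : x = a
    · subst hx; simp [ha]
    · simp [hx]
  rw [h1, h2, Finset.prod_insert (by simp [ha]), Finset.prod_insert haT]
  ring

theorem bernE_add (s : Finset E) (z : E → ℝ) (f g : Finset E → ℝ) :
    bernE s z (fun T => f T + g T) = bernE s z f + bernE s z g := by
  simp only [bernE, mul_add, Finset.sum_add_distrib]

theorem bernE_sub (s : Finset E) (z : E → ℝ) (f g : Finset E → ℝ) :
    bernE s z (fun T => f T - g T) = bernE s z f - bernE s z g := by
  simp only [bernE, mul_sub, Finset.sum_sub_distrib]

theorem bernE_mono {s : Finset E} {z : E → ℝ} (h0 : ∀ e, 0 ≤ z e) (h1 : ∀ e, z e ≤ 1)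
    {f g : Finset E → ℝ} (h : ∀ T ⊆ s, f T ≤ g T) : bernE s z f ≤ bernE s z g := by
  refine Finset.sum_le_sum fun T hT => mul_le_mul_of_nonneg_left (h T (Finset.mem_powerset.1 hT)) ?_
  exact mul_nonneg (Finset.prod_nonneg fun e _ => h0 e)
    (Finset.prod_nonneg fun e _ => sub_nonneg.2 (h1 e))

theorem bernE_const (s : Finset E) (z : E → ℝ) (c : ℝ) : bernE s z (fun _ => c) = c := by
  induction s using Finset.induction_on with
  | empty => simp [bernE]
  | insert a s ha ih => rw [bernE_insert ha, ← ih]; congr 1; funext; rw [ih]; ring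

theorem bernE_card_inter (s : Finset E) (z : E → ℝ) (N : Finset E) :
    bernE s z (fun T => ((T ∩ N).card : ℝ)) = ∑ e ∈ s ∩ N, z e := by
  induction s using Finset.induction_on with
  | empty => simp [bernE]
  | insert a s ha ih =>
    rw [bernE_insert ha]
    by_cases haN : a ∈ N
    · have hcongr : bernE s z (fun T => (1 - z a) * ((T ∩ N).card : ℝ) +
          z a * ((insert a T ∩ N).card : ℝ)) = bernE s z (fun T => ((T ∩ N).card : ℝ) + z a) := by
        refine Finset.sum_congr rfl fun T hT => ?_
        have haT : a ∉ T := fun h => ha (Finset.mem_powerset.1 hT h)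
        have hc : (insert a T ∩ N).card = (T ∩ N).card + 1 := by
          rw [Finset.insert_inter_of_mem haN, Finset.card_insert_of_notMem (by simp [haT])]
        simp only [hc]
        push_cast
        ring
      rw [hcongr, bernE_add, bernE_const, ih, Finset.insert_inter_of_mem haN,
        Finset.sum_insert (by simp [ha]), add_comm]
    · rw [Finset.insert_inter_of_notMem haN, ← ih]
      congr 1
      funext T
      rw [Finset.insert_inter_of_notMem haN]
      ring

/-- The one-coordinate case of `bernE_exp_le`. -/
theorem one_add_exp_mul_le {l x d : ℝ} (hl : 0 ≤ l) (hx : 0 ≤ x) (hd0 : 0 ≤ d) (hd : d ≤ 1) :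
    1 + Real.exp (-l) * x * (Real.exp (l * d) - 1) ≤ Real.exp (l * (x * d)) := by
  have h1 : Real.exp (-l) * (Real.exp (l * d) - 1) ≤ l * d := by
    -- The Lipschitz bound `d ≤ 1` enters only here, through `exp (-l) ≤ exp (-(l * d))`.
    have h : Real.exp (-l) * (Real.exp (l * d) - 1) ≤
        Real.exp (-(l * d)) * (Real.exp (l * d) - 1) := by
      refine mul_le_mul_of_nonneg_right (Real.exp_le_exp.2 ?_) ?_
      · nlinarith
      · have := Real.add_one_le_exp (l * d); nlinarith [mul_nonneg hl hd0]
    have h2 : Real.exp (-(l * d)) * (Real.exp (l * d) - 1) = 1 - Real.exp (-(l * d)) := by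
      rw [mul_sub, ← Real.exp_add]; simp
    have := Real.add_one_le_exp (-(l * d))
    linarith
  have h2 := Real.add_one_le_exp (l * (x * d))
  nlinarith [mul_le_mul_of_nonneg_left h1 hx]

/-- Bicriterion concentration: for an antitone function `h` that drops by at most one when a point
is added, the lower tail of `h` at the reduced rates `exp (-l) * z` is governed by the mean of `h`
at the rates `z`. Comparing two different rates makes the bound independent of the variance of `h`;
it tensorises, so the proof integrates out one coordinate at a time. -/
theorem bernE_exp_le {l : ℝ} (hl : 0 ≤ l) {z : E → ℝ} (h0 : ∀ e, 0 ≤ z e) (h1 : ∀ e, z e ≤ 1)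
    (s : Finset E) (h : Finset E → ℝ) (hanti : ∀ T a, h (insert a T) ≤ h T)
    (hlip : ∀ T a, h T ≤ h (insert a T) + 1) :
    bernE s (fun e => Real.exp (-l) * z e) (fun T => Real.exp (-l * h T)) ≤
      Real.exp (-l * bernE s z h) := by
  have hq : ∀ e, 0 ≤ Real.exp (-l) * z e ∧ Real.exp (-l) * z e ≤ 1 := fun e =>
    ⟨mul_nonneg (Real.exp_pos _).le (h0 e),
      mul_le_one₀ (Real.exp_le_one_iff.2 (by linarith)) (h0 e) (h1 e)⟩
  induction s using Finset.induction_on generalizing h with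
  | empty => simp [bernE]
  | insert a s ha ih =>
    rw [bernE_insert ha, bernE_insert ha]
    refine le_trans (bernE_mono (fun e => (hq e).1) (fun e => (hq e).2) fun T _ => ?_)
      (ih (fun T => (1 - z a) * h T + z a * h (insert a T)) (fun T b => ?_) (fun T b => ?_))
    · have key := one_add_exp_mul_le hl (h0 a) (sub_nonneg.2 (hanti T a))
        (by linarith [hlip T a] : h T - h (insert a T) ≤ 1)
      have e1 : Real.exp (-l * h (insert a T)) =
          Real.exp (-l * h T) * Real.exp (l * (h T - h (insert a T))) := by
        rw [← Real.exp_add]; ring_nf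
      have e2 : Real.exp (-l * ((1 - z a) * h T + z a * h (insert a T))) =
          Real.exp (-l * h T) * Real.exp (l * (z a * (h T - h (insert a T)))) := by
        rw [← Real.exp_add]; ring_nf
      rw [e1, e2]
      nlinarith [mul_le_mul_of_nonneg_left key (Real.exp_pos (-l * h T)).le]
    · have := hanti (insert a T) b
      rw [Finset.insert_comm] at this
      nlinarith [mul_le_mul_of_nonneg_left (hanti T b) (sub_nonneg.2 (h1 a)),
        mul_le_mul_of_nonneg_left this (h0 a)]
    · have := hlip (insert a T) b
      rw [Finset.insert_comm] at this
      nlinarith [mul_le_mul_of_nonneg_left (hlip T b) (sub_nonneg.2 (h1 a)),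
        mul_le_mul_of_nonneg_left this (h0 a)]

end Bern

/-! ### Blocked elements and the choice of a chain -/

section Chain

variable {E : Type*} [DecidableEq E]

/-- `T` is independent in the `k`-fold union of the contraction `r / S`, expressed by the counting
condition `|T'| ≤ k (r (T' ∪ S) - r S)` on subsets `T' ⊆ T`. -/
def ContractIndep (r : Finset E → ℕ) (k : ℕ) (S T : Finset E) : Prop :=
  ∀ T' ⊆ T, T'.card + k * r S ≤ k * r (T' ∪ S)

/-- The random set `R` contains an independent set `T ⊆ L`, with `e ∉ T`, that spans `e` in the
`k`-fold union of the contraction `r / S`: the set `T ∪ {e}` has exhausted its capacity. -/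
def Blocked (r : Finset E → ℕ) (k : ℕ) (S L : Finset E) (e : E) (R : Finset E) : Prop :=
  ∃ T ⊆ R.erase e, T ⊆ L ∧ ContractIndep r k S T ∧
    k * r (insert e (T ∪ S)) ≤ T.card + k * r S

theorem blocked_erase {r : Finset E → ℕ} {k : ℕ} {S L : Finset E} {e : E} {R : Finset E} :
    Blocked r k S L e (R.erase e) ↔ Blocked r k S L e R := by
  simp [Blocked]

/-- The rank of `R ∩ N` in the `k`-fold union of `(r | N) / S`, shifted by `k * r S`. -/
noncomputable def shiftedRank (r : Finset E → ℕ) (k : ℕ) (N S R : Finset E) : ℕ :=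
  sInf {n | ∃ X, S ⊆ X ∧ X ⊆ N ∧ n = k * r X + ((R ∩ N) \ X).card}

variable {r : Finset E → ℕ} {k : ℕ} {N S : Finset E}

theorem shiftedRank_le {X : Finset E} (h1 : S ⊆ X) (h2 : X ⊆ N) (R : Finset E) :
    shiftedRank r k N S R ≤ k * r X + ((R ∩ N) \ X).card :=
  Nat.sInf_le ⟨X, h1, h2, rfl⟩

theorem exists_shiftedRank_eq (hS : S ⊆ N) (R : Finset E) :
    ∃ X, S ⊆ X ∧ X ⊆ N ∧ shiftedRank r k N S R = k * r X + ((R ∩ N) \ X).card :=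
  Nat.sInf_mem (s := {n | ∃ X, S ⊆ X ∧ X ⊆ N ∧ n = k * r X + ((R ∩ N) \ X).card})
    ⟨_, S, subset_rfl, hS, rfl⟩

theorem shiftedRank_mono_left {S' : Finset E} (h : S ⊆ S') (hS' : S' ⊆ N) (R : Finset E) :
    shiftedRank r k N S R ≤ shiftedRank r k N S' R := by
  obtain ⟨X, h1, h2, h3⟩ := exists_shiftedRank_eq (r := r) (k := k) hS' R
  exact h3 ▸ shiftedRank_le (h.trans h1) h2 R

theorem shiftedRank_le_insert (hS : S ⊆ N) (R : Finset E) (a : E) :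
    shiftedRank r k N S R ≤ shiftedRank r k N S (insert a R) := by
  obtain ⟨X, h1, h2, h3⟩ := exists_shiftedRank_eq (r := r) (k := k) hS (insert a R)
  rw [h3]
  refine (shiftedRank_le h1 h2 R).trans (Nat.add_le_add_left (Finset.card_le_card ?_) _)
  gcongr
  exact Finset.subset_insert a R

theorem shiftedRank_insert_le (hS : S ⊆ N) (R : Finset E) (a : E) :
    shiftedRank r k N S (insert a R) ≤ shiftedRank r k N S R + 1 := by
  obtain ⟨X, h1, h2, h3⟩ := exists_shiftedRank_eq (r := r) (k := k) hS R
  rw [h3]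
  refine (shiftedRank_le h1 h2 (insert a R)).trans ?_
  have hsub : (insert a R ∩ N) \ X ⊆ insert a ((R ∩ N) \ X) := by
    intro x; simp only [Finset.mem_sdiff, Finset.mem_inter, Finset.mem_insert]; tauto
  have := (Finset.card_le_card hsub).trans (Finset.card_insert_le _ _)
  omega

/-- Contracting more makes the marginal contribution of `a` smaller. -/
theorem shiftedRank_insert_sub_le (hr : IsPolymatroid r) {S' : Finset E} (h : S ⊆ S')
    (hS' : S' ⊆ N) (R : Finset E) (a : E) :
    shiftedRank r k N S' (insert a R) + shiftedRank r k N S R ≤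
      shiftedRank r k N S' R + shiftedRank r k N S (insert a R) := by
  have hS := h.trans hS'
  by_cases haR : a ∈ R
  · rw [Finset.insert_eq_of_mem haR]
  rcases (shiftedRank_le_insert (r := r) (k := k) hS R a).lt_or_eq with hlt | heq
  · have := shiftedRank_insert_le (r := r) (k := k) hS' R a
    omega
  -- If `a` adds nothing over `S`, a minimiser `W` for `insert a R` also serves `R`; joining it to
  -- a minimiser over `S'` shows that `a` adds nothing over `S'`.
  obtain ⟨W, hW1, hW2, hW⟩ := exists_shiftedRank_eq (r := r) (k := k) hS (insert a R)
  obtain ⟨V, hV1, hV2, hV⟩ := exists_shiftedRank_eq (r := r) (k := k) hS' R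
  have hle := shiftedRank_le (r := r) (k := k) (hV1.trans Finset.subset_union_left)
    (Finset.union_subset hV2 hW2) (insert a R)
  have hcap := shiftedRank_le (r := r) (k := k) (Finset.subset_inter (h.trans hV1) hW1)
    (Finset.inter_subset_left.trans hV2) R
  have hsub := Nat.mul_le_mul_left k (hr.submod V W)
  rw [mul_add, mul_add] at hsub
  have hcard : ((insert a R ∩ N) \ (V ∪ W)).card + ((R ∩ N) \ (V ∩ W)).card ≤
      ((R ∩ N) \ V).card + ((insert a R ∩ N) \ W).card := by
    rw [← Finset.card_union_add_card_inter ((R ∩ N) \ V)]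
    have h1 : (R ∩ N) \ (V ∩ W) ⊆ ((R ∩ N) \ V) ∪ ((insert a R ∩ N) \ W) := by
      intro x; simp only [Finset.mem_sdiff, Finset.mem_inter, Finset.mem_insert, Finset.mem_union]
      tauto
    have h2 : (insert a R ∩ N) \ (V ∪ W) ⊆ ((R ∩ N) \ V) ∩ ((insert a R ∩ N) \ W) := by
      have haW : a ∈ N → a ∈ W := by
        intro haN
        by_contra haW
        have h3 := shiftedRank_le (r := r) (k := k) hW1 hW2 R
        have h4 : (insert a R ∩ N) \ W = insert a ((R ∩ N) \ W) := by
          rw [Finset.insert_inter_of_mem haN, Finset.insert_sdiff_of_notMem _ haW]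
        rw [h4, Finset.card_insert_of_notMem (by simp [haR])] at hW
        omega
      intro x; simp only [Finset.mem_sdiff, Finset.mem_inter, Finset.mem_insert, Finset.mem_union]
      rintro ⟨⟨rfl | hx, hN⟩, hx2⟩
      · exact absurd (Or.inr (haW hN)) hx2
      · tauto
    have := Finset.card_le_card h1
    have := Finset.card_le_card h2
    omega
  omega

/-- Contracting elements of the span changes nothing. -/
theorem shiftedRank_le_of_rank_eq (hr : IsPolymatroid r) {S' : Finset E} (h : S ⊆ S')
    (hS' : S' ⊆ N) (heq : r S' = r S) (R : Finset E) :
    shiftedRank r k N S' R ≤ shiftedRank r k N S R := by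
  obtain ⟨W, hW1, hW2, hW⟩ := exists_shiftedRank_eq (r := r) (k := k) (h.trans hS') R
  rw [hW]
  refine (shiftedRank_le (X := W ∪ S') Finset.subset_union_right (Finset.union_subset hW2 hS')
    R).trans (add_le_add (Nat.mul_le_mul_left k ?_) (Finset.card_le_card
      (Finset.sdiff_subset_sdiff subset_rfl Finset.subset_union_left)))
  have h1 := hr.submod W S'
  have h2 := hr.mono (Finset.subset_inter hW1 h)
  omega

theorem shiftedRank_self (R : Finset E) : shiftedRank r k N N R = k * r N := by
  refine le_antisymm ((shiftedRank_le subset_rfl subset_rfl R).trans ?_) ?_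
  · simp
  · obtain ⟨X, h1, h2, h3⟩ := exists_shiftedRank_eq (r := r) (k := k) (subset_refl N) R
    rw [h3, subset_antisymm h2 h1]
    exact Nat.le_add_right _ _

theorem shiftedRank_empty_le (hr : IsPolymatroid r) (R : Finset E) :
    shiftedRank r k N ∅ R ≤ (R ∩ N).card :=
  (shiftedRank_le subset_rfl (Finset.empty_subset N) R).trans (by simp [hr.empty])

/-- A blocked element has no room: joining the tight set `T ∪ S ∪ {e}` to a minimiser over `S` gives
a minimiser that contains `e`. -/
theorem Blocked.shiftedRank_le (hr : IsPolymatroid r) (hS : S ⊆ N) {e : E} (he : e ∈ N)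
    {R : Finset E} (hb : Blocked r k S (N \ S) e R) :
    shiftedRank r k N (insert e S) R ≤ shiftedRank r k N S R := by
  obtain ⟨T, hTR, hTL, hT, hcard⟩ := hb
  obtain ⟨W, hW1, hW2, hW⟩ := exists_shiftedRank_eq (r := r) (k := k) hS R
  have hUN : insert e (T ∪ S) ⊆ N := Finset.insert_subset he
    (Finset.union_subset (hTL.trans Finset.sdiff_subset) hS)
  refine (Prophet.shiftedRank_le (X := W ∪ insert e (T ∪ S)) ?_
    (Finset.union_subset hW2 hUN) R).trans ?_
  · exact (Finset.insert_subset_insert e Finset.subset_union_right).trans Finset.subset_union_right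
  rw [hW]
  have hsub := Nat.mul_le_mul_left k (hr.submod W (insert e (T ∪ S)))
  rw [mul_add, mul_add] at hsub
  -- The part of `T` inside `W` is independent, so the part outside `W` is at least as large as the
  -- rank increment from `W`.
  have hTW := hT (T ∩ W) Finset.inter_subset_left
  have hmono : k * r (T ∩ W ∪ S) ≤ k * r (W ∩ insert e (T ∪ S)) := by
    refine Nat.mul_le_mul_left k (hr.mono ?_)
    intro x; simp only [Finset.mem_union, Finset.mem_inter, Finset.mem_insert]
    have := @hW1 x
    tauto
  have hsplit : (T \ W).card + ((R ∩ N) \ (W ∪ insert e (T ∪ S))).card ≤ ((R ∩ N) \ W).card := by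
    rw [← Finset.card_union_of_disjoint]
    · refine Finset.card_le_card ?_
      intro x
      simp only [Finset.mem_union, Finset.mem_inter, Finset.mem_insert, Finset.mem_sdiff]
      have h1 := @hTR x
      have h2 := @hTL x
      simp only [Finset.mem_erase, Finset.mem_sdiff] at h1 h2
      tauto
    · rw [Finset.disjoint_left]
      intro x
      simp only [Finset.mem_union, Finset.mem_inter, Finset.mem_insert, Finset.mem_sdiff]
      tauto
  have := Finset.card_inter_add_card_sdiff T W
  omega

/-- If the rates `z` put at most `(1 - ε) k r N` mass on `N`, some proper subset `S` of `N` leaves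
every `e ∈ N \ S` an expected room of at least `ε k`, the room being the rank increment from
contracting `e` as well. Such an `S` is found by minimising the expected shifted rank minus
`ε k r S`, among minimisers of less than full rank, with maximal cardinality. -/
theorem exists_contraction [Fintype E] (hr : IsPolymatroid r) {ε : ℝ} (hε : 0 ≤ ε) {z : E → ℝ}
    (h0 : ∀ e, 0 ≤ z e) (h1 : ∀ e, z e ≤ 1) (hN : ∑ e ∈ N, z e ≤ (1 - ε) * (k * r N))
    (hpos : 0 < r N) :
    ∃ S ⊂ N, ∀ e ∈ N \ S, ε * k ≤ bernE Finset.univ z fun R =>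
      (shiftedRank r k N (insert e S) R : ℝ) - shiftedRank r k N S R := by
  set Ψ : Finset E → ℝ := fun S =>
    bernE Finset.univ z (fun R => (shiftedRank r k N S R : ℝ)) - ε * k * r S with hΨ
  have hΨ_eq : ∀ {S S' : Finset E}, S ⊆ S' → S' ⊆ N → r S' = r S → Ψ S' = Ψ S := by
    intro S S' h h' heq
    have : ∀ R, shiftedRank r k N S' R = shiftedRank r k N S R := fun R =>
      le_antisymm (shiftedRank_le_of_rank_eq hr h h' heq R) (shiftedRank_mono_left h h' R)
    simp only [hΨ, this, heq]
  have hΨ_empty : Ψ ∅ ≤ Ψ N := by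
    have h2 : bernE Finset.univ z (fun R => (shiftedRank r k N ∅ R : ℝ)) ≤ ∑ e ∈ N, z e := by
      rw [← Finset.univ_inter N, ← bernE_card_inter, Finset.univ_inter]
      exact bernE_mono h0 h1 fun T _ => by exact_mod_cast shiftedRank_empty_le hr T
    have h3 : bernE Finset.univ z (fun R => (shiftedRank r k N N R : ℝ)) = k * r N := by
      simp only [shiftedRank_self, bernE_const]; push_cast; ring
    simp only [hΨ, hr.empty, h3]
    push_cast
    nlinarith
  obtain ⟨S₀, hS₀, hmin⟩ := Finset.exists_min_image N.powerset Ψ ⟨N, by simp⟩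
  -- A minimiser of full rank has the same value as `N`, hence as `∅`, which then also minimises.
  have hlow : ∃ S ∈ N.powerset.filter (fun S => r S < r N), Ψ S = Ψ S₀ := by
    rcases (hr.mono (Finset.mem_powerset.1 hS₀)).lt_or_eq with hlt | heq
    · exact ⟨S₀, Finset.mem_filter.2 ⟨hS₀, hlt⟩, rfl⟩
    · refine ⟨∅, by simp [hr.empty, hpos], le_antisymm ?_ (hmin ∅ (by simp))⟩
      rw [← hΨ_eq (Finset.mem_powerset.1 hS₀) subset_rfl heq.symm]
      exact hΨ_empty
  obtain ⟨S, hS, hmax⟩ := Finset.exists_max_image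
    ((N.powerset.filter (fun S => r S < r N)).filter fun S => Ψ S = Ψ S₀) Finset.card
    (by obtain ⟨S, h, h'⟩ := hlow; exact ⟨S, Finset.mem_filter.2 ⟨h, h'⟩⟩)
  simp only [Finset.mem_filter, Finset.mem_powerset] at hS hmax
  obtain ⟨⟨hSN, hlt⟩, hSΨ⟩ := hS
  -- By maximality of the cardinality, no `e ∈ N \ S` lies in the span of `S`.
  refine ⟨S, hSN.ssubset_of_ne (by rintro rfl; exact hlt.ne rfl), fun e he => ?_⟩
  obtain ⟨heN, heS⟩ := Finset.mem_sdiff.1 he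
  have hins : insert e S ⊆ N := Finset.insert_subset heN hSN
  have hrank : r S < r (insert e S) := by
    refine lt_of_le_of_ne (hr.mono (Finset.subset_insert e S)) fun heq => ?_
    have := hmax (insert e S) ⟨⟨hins, heq ▸ hlt⟩,
      (hΨ_eq (Finset.subset_insert e S) hins heq.symm).trans hSΨ⟩
    rw [Finset.card_insert_of_notMem heS] at this
    omega
  have hge := hmin _ (Finset.mem_powerset.2 hins)
  rw [← hSΨ] at hge
  simp only [hΨ] at hge
  have hrank' : (r S : ℝ) + 1 ≤ r (insert e S) := by exact_mod_cast hrank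
  rw [bernE_sub]
  nlinarith [mul_le_mul_of_nonneg_left hrank' (mul_nonneg hε (Nat.cast_nonneg k : (0 : ℝ) ≤ k))]

open Classical in
/-- Expected room at the rates `z` bounds the probability of being blocked at the reduced rates. -/
theorem bernE_blocked_le [Fintype E] (hr : IsPolymatroid r) {l c : ℝ} (hl : 0 ≤ l)
    {z : E → ℝ} (h0 : ∀ e, 0 ≤ z e) (h1 : ∀ e, z e ≤ 1) (hS : S ⊆ N) {e : E} (he : e ∈ N)
    (hc : c ≤ bernE Finset.univ z fun R =>
      (shiftedRank r k N (insert e S) R : ℝ) - shiftedRank r k N S R) :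
    bernE Finset.univ (fun e => Real.exp (-l) * z e)
      (fun R => if Blocked r k S (N \ S) e R then 1 else 0) ≤ Real.exp (-(l * c)) := by
  have hins : insert e S ⊆ N := Finset.insert_subset he hS
  have hq : ∀ e, 0 ≤ Real.exp (-l) * z e ∧ Real.exp (-l) * z e ≤ 1 := fun e =>
    ⟨mul_nonneg (Real.exp_pos _).le (h0 e),
      mul_le_one₀ (Real.exp_le_one_iff.2 (by linarith)) (h0 e) (h1 e)⟩
  refine (bernE_mono (fun e => (hq e).1) (fun e => (hq e).2) fun R _ => ?_).trans
    ((bernE_exp_le hl h0 h1 Finset.univ (fun R =>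
      (shiftedRank r k N (insert e S) R : ℝ) - shiftedRank r k N S R) (fun R a => ?_)
      (fun R a => ?_)).trans (Real.exp_le_exp.2 (by nlinarith)))
  · split_ifs with hb
    · have : shiftedRank r k N (insert e S) R = shiftedRank r k N S R :=
        le_antisymm (hb.shiftedRank_le hr hS he)
          (shiftedRank_mono_left (Finset.subset_insert e S) hins R)
      simp [this]
    · exact (Real.exp_pos _).le
  · have h : ((shiftedRank r k N (insert e S) (insert a R) + shiftedRank r k N S R : ℕ) : ℝ) ≤
        (shiftedRank r k N (insert e S) R + shiftedRank r k N S (insert a R) : ℕ) := by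
      exact_mod_cast shiftedRank_insert_sub_le hr (Finset.subset_insert e S) hins R a
    push_cast at h
    linarith
  · have h2 : (shiftedRank r k N (insert e S) R : ℝ) ≤
        shiftedRank r k N (insert e S) (insert a R) := by
      exact_mod_cast shiftedRank_le_insert hins R a
    have h3 : (shiftedRank r k N S (insert a R) : ℝ) ≤ shiftedRank r k N S R + 1 := by
      exact_mod_cast shiftedRank_insert_le hS R a
    linarith

open Classical in
/-- The chain decomposition: a level function whose sublevel sets form a chain such that within
each level no element of positive rate is likely to be blocked. -/
theorem exists_level [Fintype E] (hr : IsPolymatroid r) {ε l : ℝ} (hε : 0 ≤ ε) (hl : 0 ≤ l)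
    {z : E → ℝ} (h0 : ∀ e, 0 ≤ z e) (h1 : ∀ e, z e ≤ 1)
    (hz : ∀ T, ∑ e ∈ T, z e ≤ (1 - ε) * (k * r T)) (N : Finset E) :
    ∃ lev : E → ℕ, ∀ e ∈ N, 0 < z e →
      bernE Finset.univ (fun e => Real.exp (-l) * z e)
        (fun R => if Blocked r k (N.filter fun f => lev f < lev e)
          (N.filter fun f => lev f = lev e) e R then 1 else 0) ≤ Real.exp (-(l * (ε * k))) := by
  induction N using Finset.strongInduction with
  | H N ih =>
  rcases Nat.eq_zero_or_pos (r N) with hzero | hpos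
  -- If `N` has rank zero, the polytope constraint makes all its rates vanish.
  · refine ⟨fun _ => 0, fun e he hpos => absurd hpos (not_lt.2 ?_)⟩
    have := hz N
    rw [hzero] at this
    simp only [Nat.cast_zero, mul_zero] at this
    exact (Finset.single_le_sum (fun f _ => h0 f) he).trans this
  obtain ⟨S, hSN, hS⟩ := exists_contraction hr hε h0 h1 (hz N) hpos
  obtain ⟨lev, hlev⟩ := ih S hSN
  set m := S.sup lev + 1 with hm
  have hlt : ∀ f ∈ S, lev f < m := fun f hf => Nat.lt_succ_of_le (Finset.le_sup hf)
  refine ⟨fun f => if f ∈ S then lev f else m, fun e he hze => ?_⟩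
  by_cases heS : e ∈ S
  · have e1 : (N.filter fun f => (if f ∈ S then lev f else m) < if e ∈ S then lev e else m) =
        S.filter fun f => lev f < lev e := by
      ext f
      simp only [Finset.mem_filter, heS, if_true]
      by_cases hf : f ∈ S
      · simp [hf, hSN.1 hf]
      · simp [hf, (hlt e heS).le]
    have e2 : (N.filter fun f => (if f ∈ S then lev f else m) = if e ∈ S then lev e else m) =
        S.filter fun f => lev f = lev e := by
      ext f
      simp only [Finset.mem_filter, heS, if_true]
      by_cases hf : f ∈ S
      · simp [hf, hSN.1 hf]
      · simp [hf, (hlt e heS).ne']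
    rw [e1, e2]
    exact hlev e heS hze
  · have e1 : (N.filter fun f => (if f ∈ S then lev f else m) < if e ∈ S then lev e else m) =
        S := by
      ext f
      simp only [Finset.mem_filter, heS, if_false]
      by_cases hf : f ∈ S
      · simp [hf, hSN.1 hf, hlt f hf]
      · simp [hf]
    have e2 : (N.filter fun f => (if f ∈ S then lev f else m) = if e ∈ S then lev e else m) =
        N \ S := by
      ext f
      simp only [Finset.mem_filter, heS, if_false, Finset.mem_sdiff]
      by_cases hf : f ∈ S
      · simp [hf, (hlt f hf).ne]
      · simp [hf]
    rw [e1, e2]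
    exact bernE_blocked_le hr hl h0 h1 hSN.1 he (hS e (Finset.mem_sdiff.2 ⟨he, heS⟩))

/-- Sets that are independent in every level of a chain satisfy the counting condition of the
whole polymatroid: the rank increments along the chain only decrease when taken over larger
sets. -/
theorem card_le_of_forall_contractIndep [Fintype E] (hr : IsPolymatroid r) (lev : E → ℕ)
    {A : Finset E} (hA : ∀ i, ContractIndep r k (Finset.univ.filter fun f => lev f < i)
      (A.filter fun f => lev f = i)) {T : Finset E} (hT : T ⊆ A) : T.card ≤ k * r T := by
  have key : ∀ i, (T.filter fun f => lev f < i).card ≤ k * r (T.filter fun f => lev f < i) := by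
    intro i
    induction i with
    | zero => simp
    | succ i ih =>
      have hsplit : (T.filter fun f => lev f < i + 1) =
          (T.filter fun f => lev f < i) ∪ (T.filter fun f => lev f = i) := by
        ext f; simp only [Finset.mem_filter, Finset.mem_union, Nat.lt_succ_iff_lt_or_eq]; tauto
      have h1 := hA i (T.filter fun f => lev f = i) (Finset.filter_subset_filter _ hT)
      set S := Finset.univ.filter fun f => lev f < i
      have h2 := hr.submod (T.filter fun f => lev f < i + 1) S
      have h3 : r ((T.filter fun f => lev f = i) ∪ S) ≤
          r ((T.filter fun f => lev f < i + 1) ∪ S) := by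
        rw [hsplit]; exact hr.mono (by gcongr; exact Finset.subset_union_right)
      have h4 : r (T.filter fun f => lev f < i) ≤ r ((T.filter fun f => lev f < i + 1) ∩ S) := by
        refine hr.mono fun f => ?_
        simp only [S, Finset.mem_filter, Finset.mem_inter, Finset.mem_univ, true_and]
        exact fun h => ⟨⟨h.1, h.2.trans (Nat.lt_succ_self i)⟩, h.2⟩
      have h5 := (congrArg Finset.card hsplit).le.trans (Finset.card_union_le _ _)
      have h6 := Nat.mul_le_mul_left k ((add_le_add h3 h4).trans h2)
      rw [mul_add, mul_add] at h6
      omega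
  have h := key (T.sup lev + 1)
  rwa [Finset.filter_true_of_mem fun f hf => Nat.lt_succ_of_le (Finset.le_sup hf)] at h

end Chain

/-! ### Product measures -/

section Product

variable {E : Type*} [Fintype E] [DecidableEq E]

/-- Resampling one coordinate of a product measure. -/
theorem measurePreserving_update {X : Type*} [MeasurableSpace X] (μ : E → Measure X)
    [∀ e, IsProbabilityMeasure (μ e)] (e : E) :
    MeasurePreserving (fun p : X × (E → X) => Function.update p.2 e p.1)
      ((μ e).prod (Measure.pi μ)) (Measure.pi μ) := by
  have hm : Measurable (fun p : X × (E → X) => Function.update p.2 e p.1) := by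
    refine measurable_pi_iff.2 fun f => ?_
    by_cases hf : f = e
    · subst hf; simpa using measurable_fst
    · simp only [Function.update_of_ne hf]
      exact (measurable_pi_apply f).comp measurable_snd
  refine ⟨hm, (Measure.pi_eq fun s hs => ?_).symm⟩
  rw [Measure.map_apply hm (MeasurableSet.univ_pi hs)]
  have hpre : (fun p : X × (E → X) => Function.update p.2 e p.1) ⁻¹' Set.univ.pi s =
      s e ×ˢ Set.univ.pi (Function.update s e Set.univ) := by
    ext ⟨t, v⟩
    simp only [Set.mem_preimage, Set.mem_pi, Set.mem_univ, true_implies, Set.mem_prod]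
    constructor
    · intro h
      refine ⟨by simpa using h e, fun f => ?_⟩
      by_cases hf : f = e
      · subst hf; simp
      · simpa [Function.update_of_ne hf] using h f
    · rintro ⟨h1, h2⟩ f
      by_cases hf : f = e
      · subst hf; simpa using h1
      · simpa [Function.update_of_ne hf] using h2 f
  rw [hpre, Measure.prod_prod, Measure.pi_pi, ← Finset.mul_prod_erase _ _ (Finset.mem_univ e),
    ← Finset.mul_prod_erase _ (fun i => μ i (s i)) (Finset.mem_univ e)]
  simp only [Function.update_self, measure_univ, one_mul]
  congr 1
  refine Finset.prod_congr rfl fun f hf => ?_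
  rw [Function.update_of_ne (Finset.ne_of_mem_erase hf)]

theorem lintegral_pi_eq_update {X : Type*} [MeasurableSpace X] (μ : E → Measure X)
    [∀ e, IsProbabilityMeasure (μ e)] (e : E) {f : (E → X) → ENNReal} (hf : Measurable f) :
    ∫⁻ v, f v ∂Measure.pi μ =
      ∫⁻ t, ∫⁻ v, f (Function.update v e t) ∂Measure.pi μ ∂μ e := by
  have h := measurePreserving_update μ e
  rw [← h.lintegral_comp hf]
  exact lintegral_prod _ (hf.comp h.measurable).aemeasurable

/-- The event that `T` is exactly the set of coordinates `f` lying in `a f`. -/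
def memBox {E X : Type*} (a : E → Set X) (T : Finset E) : Set (E → X) :=
  open Classical in Set.univ.pi fun f => if f ∈ T then a f else (a f)ᶜ

theorem measurableSet_memBox {X : Type*} [MeasurableSpace X] {a : E → Set X}
    (ha : ∀ e, MeasurableSet (a e)) (T : Finset E) : MeasurableSet (memBox a T) :=
  MeasurableSet.univ_pi fun f => by
    split_ifs
    · exact ha f
    · exact (ha f).compl

open Classical in
theorem eq_sum_indicator_memBox {X : Type*} (a : E → Set X) (c : Finset E → ENNReal) (w : E → X) :
    c (Finset.univ.filter fun f => w f ∈ a f) =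
      ∑ T : Finset E, (memBox a T).indicator (fun _ => c T) w := by
  have hmem : ∀ T, w ∈ memBox a T ↔ (Finset.univ.filter fun f => w f ∈ a f) = T := by
    intro T
    simp only [memBox, Set.mem_pi, Set.mem_univ, true_implies, Finset.ext_iff, Finset.mem_filter,
      Finset.mem_univ, true_and]
    refine forall_congr' fun f => ?_
    by_cases hf : f ∈ T <;> simp [hf]
  rw [Finset.sum_eq_single (Finset.univ.filter fun f => w f ∈ a f)]
  · rw [Set.indicator_of_mem ((hmem _).2 rfl)]
  · intro T _ hT
    rw [Set.indicator_of_notMem fun h => hT ((hmem _).1 h).symm]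
  · simp

open Classical in
theorem measurable_filter_mem {X : Type*} [MeasurableSpace X] {a : E → Set X}
    (ha : ∀ e, MeasurableSet (a e)) (c : Finset E → ENNReal) :
    Measurable fun w : E → X => c (Finset.univ.filter fun f => w f ∈ a f) := by
  simp only [eq_sum_indicator_memBox a c]
  exact Finset.measurable_sum _ fun T _ => measurable_const.indicator (measurableSet_memBox ha T)

open Classical in
/-- The random set of coordinates lying in prescribed sets of probabilities `z` includes each
element independently with probability `z`. -/
theorem lintegral_filter_mem {X : Type*} [MeasurableSpace X] (μ : E → Measure X)
    [∀ e, IsProbabilityMeasure (μ e)] {a : E → Set X} (ha : ∀ e, MeasurableSet (a e))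
    {z : E → ℝ} (h0 : ∀ e, 0 ≤ z e) (h1 : ∀ e, z e ≤ 1) (hz : ∀ e, μ e (a e) = ENNReal.ofReal (z e))
    {c : Finset E → ℝ} (hc : ∀ T, 0 ≤ c T) :
    ∫⁻ w, ENNReal.ofReal (c (Finset.univ.filter fun f => w f ∈ a f)) ∂Measure.pi μ =
      ENNReal.ofReal (bernE Finset.univ z c) := by
  simp only [eq_sum_indicator_memBox a fun T => ENNReal.ofReal (c T)]
  rw [lintegral_finsetSum _ fun T _ => measurable_const.indicator (measurableSet_memBox ha T),
    bernE, Finset.powerset_univ, ENNReal.ofReal_sum_of_nonneg]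
  · refine Finset.sum_congr rfl fun T _ => ?_
    rw [lintegral_indicator_const (measurableSet_memBox ha T), memBox, Measure.pi_pi, mul_comm,
      ENNReal.ofReal_mul' (hc T), ENNReal.ofReal_mul (Finset.prod_nonneg fun f _ => h0 f),
      ENNReal.ofReal_prod_of_nonneg fun f _ => h0 f,
      ENNReal.ofReal_prod_of_nonneg fun f _ => sub_nonneg.2 (h1 f),
      ← Finset.prod_mul_prod_compl T, ← Finset.compl_eq_univ_sdiff]
    congr 2
    · refine Finset.prod_congr rfl fun f hf => ?_
      rw [if_pos hf, hz]
    · refine Finset.prod_congr rfl fun f hf => ?_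
      rw [if_neg (Finset.mem_compl.1 hf), prob_compl_eq_one_sub (ha f), hz,
        ENNReal.ofReal_sub _ (h0 f), ENNReal.ofReal_one]
  · intro T _
    exact mul_nonneg (mul_nonneg (Finset.prod_nonneg fun e _ => h0 e)
      (Finset.prod_nonneg fun e _ => sub_nonneg.2 (h1 e))) (hc T)

open Classical in
/-- The value of `e` on the event that `e` is active is independent of any function of the other
active elements. -/
theorem lintegral_mul_filter_mem {X : Type*} [MeasurableSpace X] (μ : E → Measure X)
    [∀ e, IsProbabilityMeasure (μ e)] {a : E → Set X} (ha : ∀ e, MeasurableSet (a e))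
    {z : E → ℝ} (h0 : ∀ e, 0 ≤ z e) (h1 : ∀ e, z e ≤ 1) (hz : ∀ e, μ e (a e) = ENNReal.ofReal (z e))
    {c : Finset E → ℝ} (hc : ∀ T, 0 ≤ c T) (e : E) (hce : ∀ T, c (T.erase e) = c T)
    {g : X → ENNReal} (hg : Measurable g) :
    ∫⁻ w, (a e).indicator g (w e) *
      ENNReal.ofReal (c (Finset.univ.filter fun f => w f ∈ a f)) ∂Measure.pi μ =
      (∫⁻ t in a e, g t ∂μ e) * ENNReal.ofReal (bernE Finset.univ z c) := by
  have hcm := measurable_filter_mem ha fun T => ENNReal.ofReal (c T)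
  have hgm := hg.indicator (ha e)
  refine (lintegral_pi_eq_update μ e ((hgm.comp (measurable_pi_apply e)).mul hcm)).trans ?_
  have hupd : ∀ t v, c (Finset.univ.filter fun f => Function.update v e t f ∈ a f) =
      c (Finset.univ.filter fun f => v f ∈ a f) := by
    intro t v
    rw [← hce, ← hce (Finset.univ.filter fun f => v f ∈ a f)]
    congr 1
    ext f
    simp only [Finset.mem_erase, Finset.mem_filter, Finset.mem_univ, true_and]
    refine and_congr_right fun hf => ?_
    rw [Function.update_of_ne hf]
  simp only [Pi.mul_apply, Function.comp_apply, Function.update_self, hupd]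
  simp only [lintegral_const_mul _ hcm, lintegral_filter_mem μ ha h0 h1 hz hc]
  rw [lintegral_mul_const _ hgm, lintegral_indicator (ha e)]

end Product

/-! ### The fractional relaxation of the prophet -/

section Relaxation

/-- The maximum-weight sets of the family `F`. -/
noncomputable def maximizers {E : Type*} [Fintype E] (F : Set (Finset E)) (v : E → ℝ) :
    Finset (Finset E) :=
  open Classical in
  Finset.univ.filter fun S => S ∈ F ∧ ∀ T ∈ F, ∑ e ∈ T, v e ≤ ∑ e ∈ S, v e

theorem maximizers_nonempty {E : Type*} [Fintype E] {F : Set (Finset E)} (hF : ∅ ∈ F)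
    (v : E → ℝ) : (maximizers F v).Nonempty := by
  classical
  obtain ⟨S, hS, hmax⟩ := Finset.exists_max_image (Finset.univ.filter fun S => S ∈ F)
    (fun S => ∑ e ∈ S, v e) ⟨∅, by simpa using hF⟩
  simp only [Finset.mem_filter, Finset.mem_univ, true_and] at hS hmax
  exact ⟨S, by simpa [maximizers] using ⟨hS, hmax⟩⟩

theorem opt_eq_of_mem_maximizers {E : Type*} [Fintype E] {F : Set (Finset E)}
    {v : E → ℝ} {S : Finset E} (hS : S ∈ maximizers F v) : opt F v = ∑ e ∈ S, v e := by
  simp only [maximizers, Finset.mem_filter, Finset.mem_univ, true_and] at hS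
  refine IsGreatest.csSup_eq ⟨⟨S, hS.1, rfl⟩, ?_⟩
  rintro _ ⟨T, hT, rfl⟩
  exact hS.2 T hT

theorem opt_nonneg {E : Type*} [Fintype E] {F : Set (Finset E)} (hF : ∅ ∈ F)
    (v : E → ℝ) : 0 ≤ opt F v := by
  obtain ⟨S, hS⟩ := maximizers_nonempty hF v
  rw [opt_eq_of_mem_maximizers hS]
  simp only [maximizers, Finset.mem_filter, Finset.mem_univ, true_and] at hS
  simpa using hS.2 ∅ hF

theorem sum_card_filter_mem {E : Type*} [DecidableEq E] (𝒮 : Finset (Finset E)) (T : Finset E)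
    (g : E → ℝ) :
    ∑ e ∈ T, g e * ((𝒮.filter fun S => e ∈ S).card : ℝ) = ∑ S ∈ 𝒮, ∑ e ∈ S ∩ T, g e := by
  simp only [Finset.card_filter, Nat.cast_sum, Finset.mul_sum]
  rw [Finset.sum_comm]
  refine Finset.sum_congr rfl fun S _ => ?_
  rw [Finset.inter_comm, ← Finset.filter_mem_eq_inter, Finset.sum_filter]
  refine Finset.sum_congr rfl fun e _ => ?_
  split_ifs <;> simp

variable {E : Type*} [Fintype E] [DecidableEq E]

/-- The fractional choice of the prophet: the fraction of the maximum-weight sets that contain `e`,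
or `0` if the value of `e` is negative. Averaging over all maximum-weight sets makes this a
measurable function of the values without any tie-breaking. -/
noncomputable def fracOpt (F : Set (Finset E)) (v : E → ℝ) (e : E) : ℝ :=
  if 0 ≤ v e then
    (((maximizers F v).filter fun S => e ∈ S).card : ℝ) / (maximizers F v).card
  else 0

variable {F : Set (Finset E)}

theorem fracOpt_nonneg (v : E → ℝ) (e : E) : 0 ≤ fracOpt F v e := by
  unfold fracOpt; split_ifs <;> positivity

theorem fracOpt_le_one (v : E → ℝ) (e : E) : fracOpt F v e ≤ 1 := by
  unfold fracOpt
  split_ifs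
  · exact div_le_one_of_le₀ (by exact_mod_cast Finset.card_filter_le _ _) (by positivity)
  · exact zero_le_one

theorem fracOpt_le (v : E → ℝ) (e : E) : fracOpt F v e ≤
    (((maximizers F v).filter fun S => e ∈ S).card : ℝ) / (maximizers F v).card := by
  unfold fracOpt
  split_ifs
  · exact le_rfl
  · positivity

theorem sum_fracOpt_le (hF : ∅ ∈ F) (v : E → ℝ) {T : Finset E} {B : ℕ}
    (hB : ∀ S ∈ F, (S ∩ T).card ≤ B) : ∑ e ∈ T, fracOpt F v e ≤ B := by
  have hpos : (0 : ℝ) < (maximizers F v).card := by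
    exact_mod_cast (maximizers_nonempty hF v).card_pos
  refine (Finset.sum_le_sum fun e _ => fracOpt_le v e).trans ?_
  rw [← Finset.sum_div, div_le_iff₀ hpos]
  have h := sum_card_filter_mem (maximizers F v) T fun _ => 1
  simp only [one_mul, Finset.sum_const, nsmul_eq_mul, mul_one] at h
  rw [h, mul_comm, ← nsmul_eq_mul]
  refine Finset.sum_le_card_nsmul _ _ _ fun S hS => ?_
  simp only [maximizers, Finset.mem_filter, Finset.mem_univ, true_and] at hS
  exact_mod_cast hB S hS.1

theorem opt_le_sum_fracOpt (hF : ∅ ∈ F) (v : E → ℝ) :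
    opt F v ≤ ∑ e, max (v e) 0 * fracOpt F v e := by
  have hpos : (0 : ℝ) < (maximizers F v).card := by
    exact_mod_cast (maximizers_nonempty hF v).card_pos
  have h1 : ∀ e, max (v e) 0 * fracOpt F v e =
      max (v e) 0 * (((maximizers F v).filter fun S => e ∈ S).card : ℝ) /
        (maximizers F v).card := by
    intro e
    unfold fracOpt
    split_ifs with h
    · rw [mul_div_assoc]
    · simp [max_eq_right (not_le.1 h).le]
  simp only [h1]
  rw [← Finset.sum_div, le_div_iff₀ hpos, sum_card_filter_mem, mul_comm, ← nsmul_eq_mul]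
  refine Finset.card_nsmul_le_sum _ _ _ fun S hS => ?_
  rw [opt_eq_of_mem_maximizers hS, Finset.inter_univ]
  exact Finset.sum_le_sum fun e _ => le_max_left _ _

theorem measurable_fracOpt (F : Set (Finset E)) (e : E) :
    Measurable fun v : E → ℝ => fracOpt F v e := by
  classical
  have hset : ∀ S : Finset E, MeasurableSet {v : E → ℝ | S ∈ maximizers F v} := by
    intro S
    simp only [maximizers, Finset.mem_filter, Finset.mem_univ, true_and]
    have heq : {v : E → ℝ | S ∈ F ∧ ∀ T ∈ F, ∑ e ∈ T, v e ≤ ∑ e ∈ S, v e} =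
        {_v : E → ℝ | S ∈ F} ∩
          ⋂ T : Finset E, ⋂ _ : T ∈ F, {v : E → ℝ | ∑ e ∈ T, v e ≤ ∑ e ∈ S, v e} := by
      ext v; simp
    rw [heq]
    refine (MeasurableSet.const _).inter ?_
    exact MeasurableSet.iInter fun T => MeasurableSet.iInter fun _ => measurableSet_le
      (Finset.measurable_sum _ fun f _ => measurable_pi_apply f)
      (Finset.measurable_sum _ fun f _ => measurable_pi_apply f)
  have hcard : ∀ (P : Finset E → Prop) [DecidablePred P], Measurable fun v : E → ℝ =>
      (((maximizers F v).filter P).card : ℝ) := by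
    intro P _
    have : ∀ v : E → ℝ, (((maximizers F v).filter P).card : ℝ) =
        ∑ S : Finset E, if S ∈ maximizers F v then (if P S then 1 else 0) else 0 := by
      intro v
      rw [Finset.card_filter, Nat.cast_sum, Finset.sum_ite_mem, Finset.univ_inter]
      simp
    simp only [this]
    exact Finset.measurable_sum _ fun S _ => Measurable.ite (hset S) measurable_const
      measurable_const
  unfold fracOpt
  refine Measurable.ite (measurableSet_le measurable_const (measurable_pi_apply e)) ?_
    measurable_const
  have h2 := hcard fun _ => True
  simp only [Finset.filter_true] at h2
  exact (hcard fun S => e ∈ S).div h2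

/-- The ex-ante relaxation: acceptance probabilities `q e t`, as functions of the value `t` of `e`
alone, whose means `x` lie in the polytope cut out by the bounds `B` and whose expected weight
dominates the reward of the prophet. They are the conditional expectations of `fracOpt` given
the value of `e`. -/
theorem exists_exAnte (hF : ∅ ∈ F) {B : Finset E → ℕ} (hB : ∀ T, ∀ S ∈ F, (S ∩ T).card ≤ B T)
    (D : E → Measure ℝ) [∀ e, IsProbabilityMeasure (D e)] :
    ∃ (q : E → ℝ → ℝ) (x : E → ℝ), (∀ e, Measurable (q e)) ∧ (∀ e t, 0 ≤ q e t) ∧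
      (∀ e t, q e t ≤ 1) ∧ (∀ e t, t < 0 → q e t = 0) ∧ (∀ e, 0 ≤ x e) ∧ (∀ e, x e ≤ 1) ∧
      (∀ e, ∫⁻ t, ENNReal.ofReal (q e t) ∂D e = ENNReal.ofReal (x e)) ∧
      (∀ T, ∑ e ∈ T, x e ≤ B T) ∧
      ∫⁻ v, ENNReal.ofReal (opt F v) ∂Measure.pi D ≤
        ∑ e, ∫⁻ t, ENNReal.ofReal t * ENNReal.ofReal (q e t) ∂D e := by
  set Y : E → (E → ℝ) → ENNReal := fun e v => ENNReal.ofReal (fracOpt F v e) with hY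
  have hYm : ∀ e, Measurable (Y e) := fun e => (measurable_fracOpt F e).ennreal_ofReal
  have hY1 : ∀ e v, Y e v ≤ 1 := fun e v => ENNReal.ofReal_le_one.2 (fracOpt_le_one v e)
  have hint1 : ∀ f : (E → ℝ) → ENNReal, (∀ v, f v ≤ 1) → ∫⁻ v, f v ∂Measure.pi D ≤ 1 := by
    intro f hf
    exact (lintegral_mono hf).trans (by simp)
  set Q : E → ℝ → ENNReal := fun e t => ∫⁻ v, Y e (Function.update v e t) ∂Measure.pi D with hQ
  have hQ1 : ∀ e t, Q e t ≤ 1 := fun e t => hint1 _ fun v => hY1 e _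
  have hQm : ∀ e, Measurable (Q e) := fun e =>
    ((hYm e).comp (measurePreserving_update D e).measurable).lintegral_prod_right'
  have hQof : ∀ e t, ENNReal.ofReal (Q e t).toReal = Q e t := fun e t =>
    ENNReal.ofReal_toReal ((hQ1 e t).trans_lt ENNReal.one_lt_top).ne
  have hX1 : ∀ e, ∫⁻ v, Y e v ∂Measure.pi D ≤ 1 := fun e => hint1 _ fun v => hY1 e _
  have hXne : ∀ e, ∫⁻ v, Y e v ∂Measure.pi D ≠ ⊤ := fun e =>
    ((hX1 e).trans_lt ENNReal.one_lt_top).ne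
  refine ⟨fun e t => (Q e t).toReal, fun e => (∫⁻ v, Y e v ∂Measure.pi D).toReal,
    fun e => (hQm e).ennreal_toReal, fun _ _ => ENNReal.toReal_nonneg,
    fun e t => ENNReal.toReal_le_of_le_ofReal zero_le_one (by simpa using hQ1 e t), ?_,
    fun _ => ENNReal.toReal_nonneg,
    fun e => ENNReal.toReal_le_of_le_ofReal zero_le_one (by simpa using hX1 e), ?_, ?_, ?_⟩
  · intro e t ht
    have : ∀ v, Y e (Function.update v e t) = 0 := fun v => by
      simp [hY, fracOpt, not_le.2 ht]
    simp [hQ, this]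
  · intro e
    simp only [hQof]
    rw [ENNReal.ofReal_toReal (hXne e), lintegral_pi_eq_update D e (hYm e)]
  · intro T
    rw [← ENNReal.toReal_sum fun e _ => hXne e, ← lintegral_finsetSum _ fun e _ => hYm e]
    refine ENNReal.toReal_le_of_le_ofReal (Nat.cast_nonneg _) ?_
    calc ∫⁻ v, ∑ e ∈ T, Y e v ∂Measure.pi D
        ≤ ∫⁻ _, ENNReal.ofReal (B T) ∂Measure.pi D := by
          refine lintegral_mono fun v => ?_
          rw [← ENNReal.ofReal_sum_of_nonneg fun e _ => fracOpt_nonneg v e]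
          exact ENNReal.ofReal_le_ofReal (sum_fracOpt_le hF v (hB T))
      _ = ENNReal.ofReal (B T) := by simp
  · have hvm : ∀ e, Measurable fun v : E → ℝ => ENNReal.ofReal (v e) * Y e v := fun e =>
      (measurable_pi_apply e).ennreal_ofReal.mul (hYm e)
    calc ∫⁻ v, ENNReal.ofReal (opt F v) ∂Measure.pi D
        ≤ ∫⁻ v, ∑ e, ENNReal.ofReal (v e) * Y e v ∂Measure.pi D := by
          refine lintegral_mono fun v => ?_
          refine (ENNReal.ofReal_le_ofReal (opt_le_sum_fracOpt hF v)).trans ?_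
          rw [ENNReal.ofReal_sum_of_nonneg fun e _ =>
            mul_nonneg (le_max_right _ _) (fracOpt_nonneg v e)]
          refine Finset.sum_le_sum fun e _ => ?_
          rw [ENNReal.ofReal_mul (le_max_right _ _), ENNReal.ofReal_max]
          simp [hY]
      _ = ∑ e, ∫⁻ v, ENNReal.ofReal (v e) * Y e v ∂Measure.pi D :=
          lintegral_finsetSum _ fun e _ => hvm e
      _ ≤ ∑ e, ∫⁻ t, ENNReal.ofReal t * ENNReal.ofReal (Q e t).toReal ∂D e := by
          refine (Finset.sum_congr rfl fun e _ => ?_).le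
          rw [lintegral_pi_eq_update D e (hvm e)]
          refine lintegral_congr fun t => ?_
          simp only [Function.update_self]
          rw [lintegral_const_mul, hQof]
          exact (hYm e).comp ((measurePreserving_update D e).measurable.comp
            measurable_prodMk_left)

end Relaxation

/-! ### The greedy algorithm -/

/-- The set accepted by the greedy rule: an arriving element is accepted if and only if it is active
and keeps the accepted set in the family `Fam`. The most recent arrival is the head of the list. -/
noncomputable def greedySet {E : Type*} [DecidableEq E] (act : E → ℝ → Prop)
    (Fam : Finset E → Prop) : List (E × ℝ) → Finset E
  | [] => ∅
  | a :: past =>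
    open Classical in
    if act a.1 a.2 ∧ Fam (insert a.1 (greedySet act Fam past)) then
      insert a.1 (greedySet act Fam past)
    else greedySet act Fam past

section Greedy

variable {E : Type*} [DecidableEq E]

theorem greedySet_mem {act : E → ℝ → Prop} {Fam : Finset E → Prop} (h : Fam ∅)
    (l : List (E × ℝ)) : Fam (greedySet act Fam l) := by
  induction l with
  | nil => exact h
  | cons a past ih =>
    rw [greedySet]
    split_ifs with hc
    · exact hc.2
    · exact ih

theorem act_of_mem_greedySet {act : E → ℝ → Prop} {Fam : Finset E → Prop} {v : E → ℝ}
    {l : List E} {e : E} (he : e ∈ greedySet act Fam (l.map fun a => (a, v a))) :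
    e ∈ l ∧ act e (v e) := by
  induction l with
  | nil => simp [greedySet] at he
  | cons a past ih =>
    rw [List.map_cons, greedySet] at he
    split_ifs at he with hc
    · rcases Finset.mem_insert.1 he with rfl | he
      · exact ⟨List.mem_cons_self, hc.1⟩
      · exact ⟨List.mem_cons_of_mem _ (ih he).1, (ih he).2⟩
    · exact ⟨List.mem_cons_of_mem _ (ih he).1, (ih he).2⟩

/-- An active element is accepted, whatever the arrival order, if it extends every member of `Fam`
formed by other active elements. -/
theorem mem_greedySet {act : E → ℝ → Prop} {Fam : Finset E → Prop} (hFam : Fam ∅) {v : E → ℝ}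
    {e : E} (hact : act e (v e))
    (hext : ∀ A, Fam A → e ∉ A → (∀ f ∈ A, act f (v f)) → Fam (insert e A))
    {l : List E} (hl : l.Nodup) (he : e ∈ l) :
    e ∈ greedySet act Fam (l.map fun a => (a, v a)) := by
  induction l with
  | nil => simp at he
  | cons a past ih =>
    rw [List.map_cons, greedySet]
    rw [List.nodup_cons] at hl
    rcases List.mem_cons.1 he with rfl | he
    · rw [if_pos]
      · exact Finset.mem_insert_self _ _
      · exact ⟨hact, hext _ (greedySet_mem hFam _)
          (fun h => hl.1 (act_of_mem_greedySet h).1) fun f hf => (act_of_mem_greedySet hf).2⟩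
    · split_ifs
      · exact Finset.mem_insert_of_mem (ih hl.2 he)
      · exact ih hl.2 he

theorem measurable_greedySet [Fintype E] {Ω' : Type*} [MeasurableSpace Ω']
    {act : Ω' → E → ℝ → Prop} (hact : ∀ e, MeasurableSet {p : (E → ℝ) × Ω' | act p.2 e (p.1 e)})
    (Fam : Finset E → Prop) (past : List E) :
    Measurable[_, ⊤] fun p : (E → ℝ) × Ω' =>
      greedySet (act p.2) Fam (past.map fun a => (a, p.1 a)) := by
  let _ : MeasurableSpace (Finset E) := ⊤
  induction past with
  | nil => exact measurable_const
  | cons e past ih =>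
    simp only [List.map_cons, greedySet]
    refine Measurable.ite ?_ ((measurable_from_top (f := fun S => insert e S)).comp ih) ih
    exact (hact e).inter (ih (MeasurableSpace.measurableSet_top (s := {S | Fam (insert e S)})))

/-- The greedy algorithm with activity rule `act` and family `Fam`. -/
noncomputable abbrev greedyAlgorithm [Fintype E] {Ω' : Type} [MeasurableSpace Ω'] (P : Measure Ω')
    [IsProbabilityMeasure P] (act : Ω' → E → ℝ → Prop)
    (hact : ∀ e, MeasurableSet {p : (E → ℝ) × Ω' | act p.2 e (p.1 e)}) (Fam : Finset E → Prop) :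
    OnlineAlgorithm E where
  Ω := Ω'
  P := P
  accept r past e x :=
    open Classical in decide (act r e x ∧ Fam (insert e (greedySet (act r) Fam past)))
  measurableSet_accept past e := by
    simp only [decide_eq_true_eq]
    exact (hact e).inter (measurable_greedySet hact Fam past
      (MeasurableSpace.measurableSet_top (s := {S | Fam (insert e S)})))

theorem greedyAlgorithm_accepted [Fintype E] {Ω' : Type} [MeasurableSpace Ω'] (P : Measure Ω')
    [IsProbabilityMeasure P] (act : Ω' → E → ℝ → Prop)
    (hact : ∀ e, MeasurableSet {p : (E → ℝ) × Ω' | act p.2 e (p.1 e)}) (Fam : Finset E → Prop)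
    (v : E → ℝ) (r : Ω') (l : List E) :
    (greedyAlgorithm P act hact Fam).accepted v r l =
      greedySet (act r) Fam (l.map fun a => (a, v a)) := by
  induction l with
  | nil => rfl
  | cons e past ih =>
    have hstep : (greedyAlgorithm P act hact Fam).accepted v r (e :: past) =
        if (greedyAlgorithm P act hact Fam).accept r (past.map fun a => (a, v a)) e (v e) = true
        then insert e ((greedyAlgorithm P act hact Fam).accepted v r past)
        else (greedyAlgorithm P act hact Fam).accepted v r past := rfl
    rw [hstep, ih, List.map_cons, greedySet]
    classical
    exact if_congr decide_eq_true_iff rfl rfl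

/-- Competitiveness of a greedy algorithm, stated for the greedy rule itself. -/
theorem greedyAlgorithm_isCompetitive [Fintype E] {Ω' : Type} [MeasurableSpace Ω'] (P : Measure Ω')
    [IsProbabilityMeasure P] (act : Ω' → E → ℝ → Prop)
    (hact : ∀ e, MeasurableSet {p : (E → ℝ) × Ω' | act p.2 e (p.1 e)}) (Fam : Finset E → Prop)
    {F : Set (Finset E)} {D : E → Measure ℝ} {c : ℝ}
    (hF : ∀ A, Fam A → A ∈ F) (hFam : Fam ∅)
    (h : ∀ order : (E → ℝ) × Ω' → List E, (∀ q, (order q).Nodup) → (∀ q e, e ∈ order q) →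
      (c : EReal) * expect (Measure.pi D) (opt F) ≤ expect ((Measure.pi D).prod P) fun q =>
        ∑ e ∈ greedySet (act q.2) Fam ((order q).map fun a => (a, q.1 a)), q.1 e) :
    IsCompetitive F D c (greedyAlgorithm P act hact Fam) := by
  have hacc := greedyAlgorithm_accepted P act hact Fam
  refine ⟨fun v r l _ => (congrArg (· ∈ F) (hacc v r l)).mpr (hF _ (greedySet_mem hFam _)),
    fun σ => ?_⟩
  refine (h (fun q => (σ.order q).1) (fun q => (σ.order q).2.1)
    (fun q => (σ.order q).2.2)).trans_eq ?_
  exact congrArg (expect _) (funext fun q =>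
    congrArg (fun S => ∑ e ∈ S, q.1 e) (hacc q.1 q.2 (σ.order q).1).symm)

/-- The sets that are independent in every level of the chain given by `lev`. -/
def LevelFamily [Fintype E] (r : Finset E → ℕ) (k : ℕ) (lev : E → ℕ) (A : Finset E) : Prop :=
  ∀ i, ContractIndep r k (Finset.univ.filter fun f => lev f < i) (A.filter fun f => lev f = i)

theorem levelFamily_empty [Fintype E] (r : Finset E → ℕ) (k : ℕ) (lev : E → ℕ) :
    LevelFamily r k lev ∅ := by
  intro i T hT
  rw [Finset.filter_empty, Finset.subset_empty] at hT
  simp [hT]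

theorem blocked_of_not_levelFamily_insert [Fintype E] {r : Finset E → ℕ} {k : ℕ} {lev : E → ℕ}
    {A R : Finset E} {e : E} (hA : LevelFamily r k lev A) (hAR : A ⊆ R.erase e)
    (hins : ¬ LevelFamily r k lev (insert e A)) :
    Blocked r k (Finset.univ.filter fun f => lev f < lev e)
      (Finset.univ.filter fun f => lev f = lev e) e R := by
  simp only [LevelFamily, ContractIndep, not_forall, not_le] at hins
  obtain ⟨i, T, hT, hlt⟩ := hins
  have heT : e ∈ T := by
    by_contra heT
    refine absurd (hA i T fun f hf => ?_) (not_le.2 hlt)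
    have := hT hf
    simp only [Finset.mem_filter, Finset.mem_insert] at this ⊢
    exact ⟨this.1.resolve_left (by rintro rfl; exact heT hf), this.2⟩
  have hi : lev e = i := (Finset.mem_filter.1 (hT heT)).2
  subst hi
  have hTA : T.erase e ⊆ A.filter fun f => lev f = lev e := by
    intro f hf
    have := hT (Finset.mem_of_mem_erase hf)
    simp only [Finset.mem_filter, Finset.mem_insert] at this ⊢
    exact ⟨this.1.resolve_left (Finset.ne_of_mem_erase hf), this.2⟩
  refine ⟨T.erase e, (hTA.trans (Finset.filter_subset _ _)).trans hAR,
    hTA.trans (Finset.filter_subset_filter _ (Finset.subset_univ _)),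
    fun T' hT' => hA _ T' (hT'.trans hTA), ?_⟩
  rw [← Finset.insert_union, Finset.insert_erase heT]
  have := Finset.card_erase_add_one heT
  omega

end Greedy

/-! ### Expected reward of the greedy algorithm -/

section Reward

/-- The uniform distribution on the unit interval. -/
noncomputable def unif : Measure ℝ := volume.restrict (Set.Icc 0 1)

instance : IsProbabilityMeasure unif := ⟨by simp [unif]⟩

theorem unif_Iio {p : ℝ} (h1 : p ≤ 1) : unif (Set.Iio p) = ENNReal.ofReal p := by
  rw [unif, Measure.restrict_apply measurableSet_Iio]
  have : Set.Iio p ∩ Set.Icc 0 1 = Set.Ico 0 p := by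
    ext u
    simp only [Set.mem_inter_iff, Set.mem_Iio, Set.mem_Icc, Set.mem_Ico]
    exact ⟨fun h => ⟨h.2.1, h.1⟩, fun h => ⟨h.2, h.1, (h.2.trans_le h1).le⟩⟩
  rw [this, Real.volume_Ico, sub_zero]

/-- Pairs of a non-negative value and a coin that make an element active, when an element of
value `t` is to be active with probability `p t`. Negative values are excluded explicitly, so that
the reward is non-negative at every point, including coins outside the unit interval. -/
def activeSet (p : ℝ → ℝ) : Set (ℝ × ℝ) := {w | 0 ≤ w.1 ∧ w.2 < p w.1}

theorem measurableSet_activeSet {p : ℝ → ℝ} (hp : Measurable p) : MeasurableSet (activeSet p) :=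
  (measurableSet_le measurable_const measurable_fst).inter
    (measurableSet_lt measurable_snd (hp.comp measurable_fst))

theorem setLIntegral_activeSet (D : Measure ℝ) [IsProbabilityMeasure D] {p : ℝ → ℝ}
    (hp : Measurable p) (h1 : ∀ t, p t ≤ 1) (hneg : ∀ t, t < 0 → p t = 0)
    {g : ℝ → ENNReal} (hg : Measurable g) :
    ∫⁻ w in activeSet p, g w.1 ∂D.prod unif = ∫⁻ t, g t * ENNReal.ofReal (p t) ∂D := by
  have hm := measurableSet_activeSet hp
  rw [← lintegral_indicator hm]
  have hgm : Measurable ((activeSet p).indicator fun w => g w.1) :=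
    (hg.comp measurable_fst).indicator hm
  rw [lintegral_prod _ hgm.aemeasurable]
  refine lintegral_congr fun t => ?_
  rcases lt_or_ge t 0 with ht | ht
  · have : ∀ u, (activeSet p).indicator (fun w => g w.1) (t, u) = 0 := fun u =>
      Set.indicator_of_notMem (fun h => absurd h.1 (not_le.2 ht)) _
    simp [this, hneg t ht]
  · have : ∀ u, (activeSet p).indicator (fun w => g w.1) (t, u) =
        (Set.Iio (p t)).indicator (fun _ => g t) u := by
      intro u
      by_cases hu : u < p t
      · rw [Set.indicator_of_mem (show (t, u) ∈ activeSet p from ⟨ht, hu⟩),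
          Set.indicator_of_mem (show u ∈ Set.Iio (p t) from hu)]
      · rw [Set.indicator_of_notMem (fun h => hu h.2),
          Set.indicator_of_notMem (show u ∉ Set.Iio (p t) from hu)]
    simp only [this]
    rw [lintegral_indicator_const measurableSet_Iio, unif_Iio (h1 t)]

/-- Attaching a coin, indexed through an enumeration `ι`, to each value. -/
theorem measurePreserving_pairing {E : Type*} [Fintype E] {n : ℕ} (ι : E ≃ Fin n)
    (D : E → Measure ℝ) [∀ e, IsProbabilityMeasure (D e)] (U : Measure ℝ) [IsProbabilityMeasure U] :
    MeasurePreserving (fun (p : (E → ℝ) × (Fin n → ℝ)) (e : E) => (p.1 e, p.2 (ι e)))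
      ((Measure.pi D).prod (Measure.pi fun _ => U)) (Measure.pi fun e => (D e).prod U) := by
  have h1 : MeasurePreserving (fun (r : Fin n → ℝ) (e : E) => r (ι e))
      (Measure.pi fun _ => U) (Measure.pi fun _ => U) := by
    have hm : Measurable (fun (r : Fin n → ℝ) (e : E) => r (ι e)) :=
      measurable_pi_iff.2 fun e => measurable_pi_apply (ι e)
    refine ⟨hm, (Measure.pi_eq fun s hs => ?_).symm⟩
    rw [Measure.map_apply hm (MeasurableSet.univ_pi hs)]
    have : (fun (r : Fin n → ℝ) (e : E) => r (ι e)) ⁻¹' Set.univ.pi s =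
        Set.univ.pi fun i => s (ι.symm i) := by
      ext r
      simp only [Set.mem_preimage, Set.mem_pi, Set.mem_univ, true_implies]
      exact ⟨fun h i => by simpa using h (ι.symm i), fun h e => by simpa using h (ι e)⟩
    rw [this, Measure.pi_pi]
    exact Equiv.prod_comp ι.symm fun e => U (s e)
  exact (measurePreserving_arrowProdEquivProdArrow ℝ ℝ E D fun _ => U).symm.comp
    ((MeasurePreserving.id (Measure.pi D)).prod h1)

variable {E : Type*} [Fintype E] [DecidableEq E]

open Classical in
/-- Against every arrival order the greedy algorithm collects at least the values of the active
elements that are not blocked by the other active elements. -/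
theorem sum_indicator_le_greedySet {r : Finset E → ℕ} {k : ℕ} {lev : E → ℕ} (p : E → ℝ → ℝ)
    (w : E → ℝ × ℝ) {l : List E} (hl : l.Nodup) (hmem : ∀ e, e ∈ l) :
    ∑ e, (activeSet (p e)).indicator (fun a => ENNReal.ofReal a.1) (w e) *
      ENNReal.ofReal (if Blocked r k (Finset.univ.filter fun f => lev f < lev e)
        (Finset.univ.filter fun f => lev f = lev e) e
        (Finset.univ.filter fun f => w f ∈ activeSet (p f)) then 0 else 1) ≤
    ENNReal.ofReal (∑ e ∈ greedySet (fun e x => (x, (w e).2) ∈ activeSet (p e))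
      (LevelFamily r k lev) (l.map fun a => (a, (w a).1)), (w e).1) := by
  set A := greedySet (fun e x => (x, (w e).2) ∈ activeSet (p e)) (LevelFamily r k lev)
    (l.map fun a => (a, (w a).1)) with hA
  have hact : ∀ e ∈ A, w e ∈ activeSet (p e) := fun e he =>
    (act_of_mem_greedySet (v := fun a => (w a).1) he).2
  rw [ENNReal.ofReal_sum_of_nonneg fun e he => (hact e he).1,
    ← Finset.sum_subset (Finset.subset_univ A)]
  · refine Finset.sum_le_sum fun e he => ?_
    rw [Set.indicator_of_mem (hact e he)]
    refine mul_le_of_le_one_right' (ENNReal.ofReal_le_one.2 ?_)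
    split_ifs <;> norm_num
  · intro e _ heA
    by_cases hw : w e ∈ activeSet (p e)
    · rw [if_pos, ENNReal.ofReal_zero, mul_zero]
      by_contra hb
      refine heA (mem_greedySet (v := fun a => (w a).1) (levelFamily_empty r k lev) hw
        (fun B hB heB hBact => ?_) hl (hmem e))
      by_contra hins
      refine hb (blocked_of_not_levelFamily_insert hB (fun f hf => ?_) hins)
      exact Finset.mem_erase.2 ⟨fun h => heB (h ▸ hf), by simpa using hBact f hf⟩
    · rw [Set.indicator_of_notMem hw, zero_mul]

open Classical in
/-- The rounding step: if activity probabilities `p e t` have means `y e` and every element of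
positive rate is blocked with probability at most `δ`, then the greedy algorithm earns at least a
`1 - δ` fraction of the expected total value of the active elements. -/
theorem le_lintegral_greedySet {r : Finset E → ℕ} {k : ℕ} {lev : E → ℕ} {n : ℕ} (ι : E ≃ Fin n)
    (D : E → Measure ℝ) [∀ e, IsProbabilityMeasure (D e)] {p : E → ℝ → ℝ}
    (hp : ∀ e, Measurable (p e)) (hp1 : ∀ e t, p e t ≤ 1)
    (hneg : ∀ e t, t < 0 → p e t = 0) {y : E → ℝ} (hy0 : ∀ e, 0 ≤ y e) (hy1 : ∀ e, y e ≤ 1)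
    (hy : ∀ e, ∫⁻ t, ENNReal.ofReal (p e t) ∂D e = ENNReal.ofReal (y e)) {δ : ℝ}
    (hδ : ∀ e, 0 < y e → bernE Finset.univ y
      (fun R => if Blocked r k (Finset.univ.filter fun f => lev f < lev e)
        (Finset.univ.filter fun f => lev f = lev e) e R then 1 else 0) ≤ δ)
    (order : (E → ℝ) × (Fin n → ℝ) → List E) (hnd : ∀ q, (order q).Nodup)
    (hall : ∀ q e, e ∈ order q) :
    ENNReal.ofReal (1 - δ) * ∑ e, ∫⁻ t, ENNReal.ofReal t * ENNReal.ofReal (p e t) ∂D e ≤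
      ∫⁻ q, ENNReal.ofReal (∑ e ∈ greedySet (fun e x => (x, q.2 (ι e)) ∈ activeSet (p e))
        (LevelFamily r k lev) ((order q).map fun a => (a, q.1 a)), q.1 e)
        ∂(Measure.pi D).prod (Measure.pi fun _ => unif) := by
  set c : E → Finset E → ℝ := fun e R =>
    if Blocked r k (Finset.univ.filter fun f => lev f < lev e)
      (Finset.univ.filter fun f => lev f = lev e) e R then 0 else 1 with hc
  have hc0 : ∀ e T, 0 ≤ c e T := fun e T => by simp only [hc]; split_ifs <;> norm_num
  have hce : ∀ e T, c e (T.erase e) = c e T := fun e T => by simp only [hc, blocked_erase]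
  have ha : ∀ e, MeasurableSet (activeSet (p e)) := fun e => measurableSet_activeSet (hp e)
  have hprob : ∀ e, (D e).prod unif (activeSet (p e)) = ENNReal.ofReal (y e) := fun e => by
    have := setLIntegral_activeSet (D e) (hp e) (hp1 e) (hneg e)
      (g := fun _ => 1) measurable_const
    simpa [hy] using this
  have hgm : Measurable fun a : ℝ × ℝ => ENNReal.ofReal a.1 := measurable_fst.ennreal_ofReal
  set φ : (E → ℝ × ℝ) → ENNReal := fun w =>
    ∑ e, (activeSet (p e)).indicator (fun a => ENNReal.ofReal a.1) (w e) *
      ENNReal.ofReal (c e (Finset.univ.filter fun f => w f ∈ activeSet (p f))) with hφ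
  have hterm : ∀ e, Measurable fun w : E → ℝ × ℝ =>
      (activeSet (p e)).indicator (fun a => ENNReal.ofReal a.1) (w e) *
      ENNReal.ofReal (c e (Finset.univ.filter fun f => w f ∈ activeSet (p f))) := fun e =>
    ((hgm.indicator (ha e)).comp (measurable_pi_apply e)).mul
      (measurable_filter_mem ha fun T => ENNReal.ofReal (c e T))
  have hφm : Measurable φ := Finset.measurable_sum _ fun e _ => hterm e
  have hpair := measurePreserving_pairing ι D unif
  calc ENNReal.ofReal (1 - δ) * ∑ e, ∫⁻ t, ENNReal.ofReal t * ENNReal.ofReal (p e t) ∂D e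
      ≤ ∑ e, (∫⁻ a in activeSet (p e), ENNReal.ofReal a.1 ∂(D e).prod unif) *
          ENNReal.ofReal (bernE Finset.univ y (c e)) := by
        rw [Finset.mul_sum]
        refine Finset.sum_le_sum fun e _ => ?_
        rw [setLIntegral_activeSet (D e) (hp e) (hp1 e) (hneg e)
          (g := fun t => ENNReal.ofReal t) ENNReal.measurable_ofReal, mul_comm]
        rcases (hy0 e).lt_or_eq with hpos | hzero
        · refine mul_le_mul_right (ENNReal.ofReal_le_ofReal ?_) _
          have h1 := bernE_sub Finset.univ y (fun _ => 1)
            (fun R => if Blocked r k (Finset.univ.filter fun f => lev f < lev e)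
              (Finset.univ.filter fun f => lev f = lev e) e R then 1 else 0)
          have h2 : (fun T : Finset E => (1 : ℝ) -
              if Blocked r k (Finset.univ.filter fun f => lev f < lev e)
              (Finset.univ.filter fun f => lev f = lev e) e T then 1 else 0) = c e := by
            funext T; simp only [hc]; split_ifs <;> norm_num
          rw [h2, bernE_const] at h1
          linarith [hδ e hpos]
        · -- An element of rate zero is almost never active, so it contributes nothing.
          have h1 := hy e
          rw [← hzero, ENNReal.ofReal_zero, lintegral_eq_zero_iff (hp e).ennreal_ofReal] at h1
          have h2 : ∫⁻ t, ENNReal.ofReal t * ENNReal.ofReal (p e t) ∂D e = 0 := by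
            refine (lintegral_eq_zero_iff
              (ENNReal.measurable_ofReal.mul (hp e).ennreal_ofReal)).2 ?_
            filter_upwards [h1] with t ht
            simp only [Pi.zero_apply] at ht
            simp [ht]
          simp [h2]
    _ = ∫⁻ w, φ w ∂Measure.pi fun e => (D e).prod unif := by
        rw [hφ, lintegral_finsetSum _ fun e _ => hterm e]
        exact Finset.sum_congr rfl fun e _ => (lintegral_mul_filter_mem _ ha hy0 hy1 hprob
          (hc0 e) e (hce e) hgm).symm
    _ = ∫⁻ q, φ (fun e => (q.1 e, q.2 (ι e)))
          ∂(Measure.pi D).prod (Measure.pi fun _ => unif) := (hpair.lintegral_comp hφm).symm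
    _ ≤ _ := lintegral_mono fun q =>
        sum_indicator_le_greedySet p (fun e => (q.1 e, q.2 (ι e))) (hnd q) (hall q)

theorem expect_of_nonneg {Ω' : Type*} [MeasurableSpace Ω'] (μ : Measure Ω') {X : Ω' → ℝ}
    (hX : ∀ ω, 0 ≤ X ω) :
    expect μ X = ((∫⁻ ω, ENNReal.ofReal (X ω) ∂μ : ENNReal) : EReal) := by
  have : ∀ ω, ENNReal.ofReal (-X ω) = 0 := fun ω =>
    ENNReal.ofReal_of_nonpos (neg_nonpos.2 (hX ω))
  simp [expect, this]

/-- Competitiveness for arbitrary parameters: slack `ε` in the polytope and thinning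
by `exp (-l)`. -/
theorem exists_isCompetitive (M : Matroid E) {k : ℕ} (D : E → Measure ℝ)
    [∀ e, IsProbabilityMeasure (D e)] {ε l c : ℝ} (hε : 0 ≤ ε) (hε1 : ε ≤ 1) (hl : 0 ≤ l)
    (hc : c ≤ Real.exp (-l) * (1 - ε) * (1 - Real.exp (-(l * (ε * k))))) :
    ∃ A : OnlineAlgorithm E, IsCompetitive (kFoldUnion M k) D c A := by
  have hr := isPolymatroid_finRk M
  have hF : ∅ ∈ kFoldUnion M k := ⟨fun _ => ∅, by simp, by ext; simp⟩
  obtain ⟨q, x, hqm, hq0, hq1, hqneg, hx0, hx1, hqx, hxT, hopt⟩ :=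
    exists_exAnte hF (B := fun T => k * finRk M T)
      (fun T S hS => card_inter_le_of_mem_kFoldUnion M hS T) D
  have hε' : 0 ≤ 1 - ε := sub_nonneg.2 hε1
  have hz0 : ∀ e, 0 ≤ (1 - ε) * x e := fun e => mul_nonneg hε' (hx0 e)
  have hz1 : ∀ e, (1 - ε) * x e ≤ 1 := fun e => mul_le_one₀ (by linarith) (hx0 e) (hx1 e)
  obtain ⟨lev, hlev⟩ := exists_level (k := k) hr hε hl hz0 hz1 (fun T => by
    rw [← Finset.mul_sum]
    refine mul_le_mul_of_nonneg_left ?_ hε'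
    exact_mod_cast hxT T) Finset.univ
  set κ := Real.exp (-l) * (1 - ε) with hκ
  have hκ0 : 0 ≤ κ := mul_nonneg (Real.exp_pos _).le hε'
  have hκ1 : κ ≤ 1 := mul_le_one₀ (Real.exp_le_one_iff.2 (by linarith)) hε' (by linarith)
  set p : E → ℝ → ℝ := fun e t => κ * q e t with hp
  have hpm : ∀ e, Measurable (p e) := fun e => (hqm e).const_mul κ
  -- Coins are indexed by `Fin n`, since the randomness has to live in the lowest universe.
  set n := Fintype.card E
  have ι : E ≃ Fin n := Fintype.equivFin E
  have hactm : ∀ e, MeasurableSet {w : (E → ℝ) × (Fin n → ℝ) |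
      (w.1 e, w.2 (ι e)) ∈ activeSet (p e)} := fun e =>
    (((measurable_pi_apply e).comp measurable_fst).prodMk
      ((measurable_pi_apply (ι e)).comp measurable_snd)) (measurableSet_activeSet (hpm e))
  refine ⟨_, greedyAlgorithm_isCompetitive (Measure.pi fun _ : Fin n => unif)
    (fun r e t => (t, r (ι e)) ∈ activeSet (p e)) hactm (LevelFamily (finRk M) k lev)
    (fun A hA => mem_kFoldUnion_of_card_le M k A fun T hT =>
      card_le_of_forall_contractIndep hr lev hA hT)
    (levelFamily_empty (finRk M) k lev) fun order hnd hall => ?_⟩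
  have hround := le_lintegral_greedySet (r := finRk M) (k := k) (lev := lev) ι D hpm
    (fun e t => mul_le_one₀ hκ1 (hq0 e t) (hq1 e t))
    (fun e t ht => by simp [hp, hqneg e t ht]) (y := fun e => Real.exp (-l) * ((1 - ε) * x e))
    (fun e => mul_nonneg (Real.exp_pos _).le (hz0 e))
    (fun e => mul_le_one₀ (Real.exp_le_one_iff.2 (by linarith)) (hz0 e) (hz1 e))
    (fun e => by
      simp only [hp, ENNReal.ofReal_mul hκ0]
      rw [lintegral_const_mul _ (hqm e).ennreal_ofReal, hqx, ← ENNReal.ofReal_mul hκ0, hκ,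
        mul_assoc])
    (δ := Real.exp (-(l * (ε * k))))
    (fun e he => hlev e (Finset.mem_univ e) ((pos_iff_pos_of_mul_pos he).1 (Real.exp_pos _)))
    order hnd hall
  rw [expect_of_nonneg _ (opt_nonneg hF), expect_of_nonneg _ fun q =>
    Finset.sum_nonneg fun e he => (act_of_mem_greedySet he).2.1]
  have hδ0 : 0 ≤ 1 - Real.exp (-(l * (ε * k))) :=
    sub_nonneg.2 (Real.exp_le_one_iff.2 (by
      have : 0 ≤ l * (ε * k) := by positivity
      linarith))
  -- Thinning multiplies the relaxed value by `κ`.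
  have hscale : ∀ e, ∫⁻ t, ENNReal.ofReal t * ENNReal.ofReal (p e t) ∂D e =
      ENNReal.ofReal κ * ∫⁻ t, ENNReal.ofReal t * ENNReal.ofReal (q e t) ∂D e := by
    intro e
    refine Eq.trans (lintegral_congr fun t => ?_) (lintegral_const_mul _
      (ENNReal.measurable_ofReal.mul (hqm e).ennreal_ofReal))
    simp only [hp, ENNReal.ofReal_mul hκ0]
    ring
  simp only [hscale, ← Finset.mul_sum] at hround
  have hmain := (mul_le_mul_right hopt (ENNReal.ofReal (1 - Real.exp (-(l * (ε * k)))) *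
    ENNReal.ofReal κ)).trans ((mul_assoc _ _ _).le.trans hround)
  rw [← ENNReal.ofReal_mul hδ0] at hmain
  refine le_trans ?_ (EReal.coe_ennreal_le_coe_ennreal_iff.2 hmain)
  rw [EReal.coe_ennreal_mul, EReal.coe_ennreal_ofReal, max_eq_left (mul_nonneg hδ0 hκ0)]
  refine mul_le_mul_of_nonneg_right ?_ (EReal.coe_ennreal_nonneg _)
  rw [mul_comm]
  exact_mod_cast hc

end Reward

theorem one_sub_three_mul_le {s k : ℝ} (hs0 : 0 ≤ s) (hs1 : s ≤ 1) (hk : 1 / k ≤ s) :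
    1 - 3 * s ≤ Real.exp (-s) * (1 - s) * (1 - 1 / k) := by
  have h1 : 1 - s ≤ Real.exp (-s) := by linarith [Real.add_one_le_exp (-s)]
  have h2 : (1 - s) * (1 - s) ≤ Real.exp (-s) * (1 - s) :=
    mul_le_mul_of_nonneg_right h1 (by linarith)
  have h3 : (1 - s) * (1 - s) * (1 - s) ≤ Real.exp (-s) * (1 - s) * (1 - 1 / k) :=
    mul_le_mul h2 (by linarith) (by linarith)
      (mul_nonneg (Real.exp_pos _).le (by linarith))
  nlinarith [mul_nonneg (mul_nonneg hs0 hs0) (by linarith : 0 ≤ 3 - s)]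

end Prophet

theorem mainTheorem2 :
    ∃ C : ℝ, 0 < C ∧
      ∀ (k : ℕ), 2 ≤ k →
      ∀ (E : Type*) [Fintype E] [DecidableEq E] (M : Matroid E), M.E = Set.univ →
      ∀ (D : E → MeasureTheory.Measure ℝ) [∀ e, MeasureTheory.IsProbabilityMeasure (D e)],
        ∃ A : Prophet.OnlineAlgorithm E,
          Prophet.IsCompetitive (Prophet.kFoldUnion M k) D
            (1 - C * Real.sqrt (Real.log k / k)) A := by
  refine ⟨3, by norm_num, fun k hk E _ _ M _ D _ => ?_⟩
  have hk2 : (2 : ℝ) ≤ k := by exact_mod_cast hk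
  have hkpos : (0 : ℝ) < k := by linarith
  have hlog : 1 / 2 ≤ Real.log k := by
    have := Real.log_le_log two_pos hk2
    linarith [Real.log_two_gt_d9]
  have hlogk : Real.log k ≤ k := (Real.log_le_sub_one_of_pos hkpos).trans (by linarith)
  have hdiv : 0 ≤ Real.log k / k := div_nonneg (by linarith) hkpos.le
  set s := Real.sqrt (Real.log k / k) with hs
  have hs0 : 0 ≤ s := Real.sqrt_nonneg _
  have hs1 : s ≤ 1 := Real.sqrt_le_one.2 ((div_le_one hkpos).2 hlogk)
  have hss : s * (s * k) = Real.log k := by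
    rw [← mul_assoc, Real.mul_self_sqrt hdiv, div_mul_cancel₀ _ hkpos.ne']
  have hks : 1 / (k : ℝ) ≤ s := by
    refine Real.le_sqrt_of_sq_le ?_
    rw [one_div, sq, div_eq_mul_inv]
    refine mul_le_mul_of_nonneg_right ?_ (inv_nonneg.2 hkpos.le)
    exact (inv_anti₀ two_pos hk2).trans (by linarith)
  refine Prophet.exists_isCompetitive M D hs0 hs1 hs0 ?_
  rw [hss, Real.exp_neg (Real.log k), Real.exp_log hkpos, ← one_div]
  exact Prophet.one_sub_three_mul_le hs0 hs1 hks
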